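/- Let $\alpha\in(0,2]$, let $p_t$ ($t>0$) be the transition density of the standard symmetric $\alpha$-stable Lévy process in $\mathbb R$ (characteristic function $e^{-t|y|^\alpha}$), and let $\mathcal T_t\varphi=p_t*\varphi$ for $t>0$, $\mathcal T_0\varphi=\varphi$. Let $\theta$ be a non-negative integer-valued random variable with $E\theta^3<\infty$. Let $X=(X(t))_{t\ge0}$ be a centered Gaussian process with values in the space $\mathcal S'$ of tempered distributions on $\mathbb R$ and covariance functional $$E\langle X(s),\varphi\rangle\langle X(t),\psi\rangle=E\theta\int_{\mathbb R}\varphi(x)\,\mathcal T_{|t-s|}\psi(x)\,dx+(\operatorname{Var}\theta-E\theta)\int_{\mathbb R}\mathcal T_s\varphi(x)\,\mathcal T_t\psi(x)\,dx,\qquad \varphi,\psi\in\mathcal S .$$ Let $\mathbf\Psi$ be the class of bounded, piecewise continuous functions $\mathbb R\to\mathbb R$ with compact support. For $f\in\mathbf\Psi$ let $\langle X(1),f\rangle$ be the $L^2$-limit of $\langle X(1),\varphi_n\rangle$, where $\varphi_n\in\mathcal S$, $\varphi_n\to f$ in $L^2(\mathbb R)$. For a family $\Psi=(\psi_t)_{t\ge0}$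 of elements of $\mathbf\Psi$ put $\varrho^\Psi_t=\langle X(1),\psi_t\rangle$, $t\ge0$. (a) Homogeneity. For all $a\in\mathbb R$ and $\varphi\in\mathcal S$, $\langle X(1),\varphi\rangle$ has the same distribution as $\langle X(1),\varphi(\cdot-a)\rangle$. If $\psi_t=1_{[0,t]}$ for all $t\ge 0$, then $\varrho^\Psi$ has stationary increments. (b) Correlation of increments. Assume that, whenever $s<t\le u<v$, the sets $\{\psi_t-\psi_s\ne0\}$ and $\{\psi_v-\psi_u\ne0\}$ are disjoint, and that either $t\mapsto\psi_t(x)$ is non-decreasing for every $x\in\mathbb R$, or $t\mapsto\psi_t(x)$ is non-decreasing for every $x\ge0$ and every function $\psi_t$ is odd. Then: (i) if $\operatorname{Var}\theta<E\theta$, the increments of $\varrho^\Psi$ are negatively correlated, i.e. $\operatorname{Cov}(\varrho^\Psi_t-\varrho^\Psi_s,\varrho^\Psi_v-\varrho^\Psi_u)\le0$ for $s<t\le u<v$; (ii) if $\operatorname{Var}\theta=E\theta$, then $\varrho^\Psi$ has independent increments; (iii) if $\operatorname{Var}\theta>E\theta$, the increments of $\varrho^\Psi$ are positively correlated, i.e.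 $\operatorname{Cov}(\varrho^\Psi_t-\varrho^\Psi_s,\varrho^\Psi_v-\varrho^\Psi_u)\ge0$ for $s<t\le u<v$. (c) Long range dependence. There is a constant $C$ depending only on $\alpha$, with $C>0$ if $\alpha<2$ and $C=0$ if $\alpha=2$, such that, for all $\varphi_1,\varphi_2$ with compact supports, both in $\mathcal S$ or both in $\mathbf\Psi$, $$\lim_{\tau\to\infty}\tau^{1+\alpha}E\langle X(1),\varphi_1\rangle\langle X(1),\varphi_2(\cdot-\tau)\rangle=C(\operatorname{Var}\theta-E\theta)\int_{\mathbb R}\varphi_1(x)\,dx\int_{\mathbb R}\varphi_2(x)\,dx .$$ In particular, with the same $C$, if $\psi_t=1_{[0,t]}$ for all $t\ge 0$, then for $0\le s\le t$ and $0\le u\le v$ $$\lim_{\tau\to\infty}\tau^{1+\alpha}E(\varrho^\Psi_t-\varrho^\Psi_s)(\varrho^\Psi_{v+\tau}-\varrho^\Psi_{u+\tau})=C(\operatorname{Var}\theta-E\theta)(t-s)(v-u).$$ (d) Path continuity. Suppose that for some $\beta\in(0,2)$ and every $T>0$ there is a constant $C(T)$ with $$\int_{\mathbb R}(\psi_{t_1}(x)-\psi_{t_2}(x))^2\,dx\le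 C(T)\,|t_1-t_2|^\beta,\qquad 0\le t_1,t_2\le T .$$ Then $\varrho^\Psi$ has a continuous version which is locally Hölder continuous (on each interval $[0,T]$) with every exponent $\gamma\in(0,\beta/2)$. -/

import Mathlib

open MeasureTheory ProbabilityTheory Filter Topology
open scoped NNReal SchwartzMap

noncomputable section

namespace DensityProcess

/-- The transition density `p_t(x)` (`t > 0`) of the standard symmetric `α`-stable Lévy process
in `ℝ`, i.e. the density with characteristic function `y ↦ exp (-t |y| ^ α)`, given by Fourier
inversion. For `α = 2` this is the centered Gaussian density with variance `2 t`. -/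
def stableDensity (α t x : ℝ) : ℝ :=
  (2 * Real.pi)⁻¹ * ∫ y : ℝ, Real.cos (x * y) * Real.exp (-(t * |y| ^ α))

/-- The semigroup `𝒯_t φ = p_t * φ` of the symmetric `α`-stable process, with `𝒯_0 = id`. -/
def stableSemigroup (α t : ℝ) (φ : ℝ → ℝ) (x : ℝ) : ℝ :=
  if t = 0 then φ x else ∫ y : ℝ, stableDensity α t (x - y) * φ y

/-- `X = (X(t))_{t ≥ 0}` is a process with values in the real tempered distributions which is
jointly centered Gaussian, with covariance functional
`E ⟨X(s), φ⟩ ⟨X(t), ψ⟩ = m ∫ φ 𝒯_{|t-s|} ψ + (v - m) ∫ 𝒯_s φ 𝒯_t ψ`. Here `m` and `v` stand for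
the mean and the variance of the number `θ` of particles per cell. -/
structure IsDensityProcess {Ω : Type*} [MeasurableSpace Ω] (P : Measure Ω) (α m v : ℝ)
    (X : ℝ≥0 → Ω → (𝓢(ℝ, ℝ) →L[ℝ] ℝ)) : Prop where
  measurable : ∀ (t : ℝ≥0) (φ : 𝓢(ℝ, ℝ)), Measurable fun ω => X t ω φ
  gaussian : IsGaussianProcess (fun (i : ℝ≥0 × 𝓢(ℝ, ℝ)) (ω : Ω) => X i.1 ω i.2) P
  centered : ∀ (t : ℝ≥0) (φ : 𝓢(ℝ, ℝ)), ∫ ω, X t ω φ ∂P = 0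
  covariance : ∀ (s t : ℝ≥0) (φ ψ : 𝓢(ℝ, ℝ)),
    ∫ ω, X s ω φ * X t ω ψ ∂P =
      m * (∫ x : ℝ, φ x * stableSemigroup α |(t : ℝ) - (s : ℝ)| ψ x) +
      (v - m) * (∫ x : ℝ, stableSemigroup α s φ x * stableSemigroup α t ψ x)

/-- The class of bounded piecewise continuous functions with compact support: finitely many
discontinuities, at each of which both one-sided limits exist. -/
structure IsTestClass (f : ℝ → ℝ) : Prop where
  bounded : ∃ M : ℝ, ∀ x, |f x| ≤ M
  hasCompactSupport : HasCompactSupport f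
  finite_discontinuities : {x : ℝ | ¬ ContinuousAt f x}.Finite
  left_limit : ∀ x : ℝ, ∃ l : ℝ, Tendsto f (𝓝[<] x) (𝓝 l)
  right_limit : ∀ x : ℝ, ∃ l : ℝ, Tendsto f (𝓝[>] x) (𝓝 l)

/-- `Z` is a random variable that arises as the extension of the random distribution `Y` to the
function `f` by `L²`-approximation: `⟨Y, φ_n⟩ → Z` in `L²(P)` for some Schwartz functions `φ_n`
with `φ_n → f` in `L²(ℝ)`. -/
def IsL2Extension {Ω : Type*} [MeasurableSpace Ω] (P : Measure Ω)
    (Y : Ω → (𝓢(ℝ, ℝ) →L[ℝ] ℝ)) (f : ℝ → ℝ) (Z : Ω → ℝ) : Prop :=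
  Measurable Z ∧ MemLp Z 2 P ∧ ∃ φ : ℕ → 𝓢(ℝ, ℝ),
    Tendsto (fun n => eLpNorm (fun x => φ n x - f x) 2 volume) atTop (𝓝 0) ∧
    Tendsto (fun n => eLpNorm (fun ω => Y ω (φ n) - Z ω) 2 P) atTop (𝓝 0)

open scoped Classical in
/-- The extended pairing `⟨Y, f⟩`, a random variable determined up to almost sure equality
(a representative is chosen). -/
def extPairing {Ω : Type*} [MeasurableSpace Ω] (P : Measure Ω)
    (Y : Ω → (𝓢(ℝ, ℝ) →L[ℝ] ℝ)) (f : ℝ → ℝ) : Ω → ℝ :=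
  if h : ∃ Z : Ω → ℝ, IsL2Extension P Y f Z then h.choose else 0

/-- The real process `ϱ_t = ⟨X(1), ψ_t⟩`, `t ≥ 0`. -/
def rho {Ω : Type*} [MeasurableSpace Ω] (P : Measure Ω)
    (X : ℝ≥0 → Ω → (𝓢(ℝ, ℝ) →L[ℝ] ℝ)) (ψ : ℝ≥0 → ℝ → ℝ) (t : ℝ≥0) : Ω → ℝ :=
  extPairing P (X 1) (ψ t)

/-- The family `ψ_t = 1_{[0,t]}`, `t ≥ 0`. -/
def unitFamily (t : ℝ≥0) : ℝ → ℝ :=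
  Set.indicator (Set.Icc (0 : ℝ) t) (fun _ => (1 : ℝ))

/-- The finite-dimensional distributions of the increments are invariant under time shifts. -/
def HasStationaryIncrements {Ω : Type*} [MeasurableSpace Ω] (ξ : ℝ≥0 → Ω → ℝ)
    (P : Measure Ω) : Prop :=
  ∀ (h : ℝ≥0) (n : ℕ) (s t : Fin n → ℝ≥0),
    IdentDistrib (fun ω (i : Fin n) => ξ (t i + h) ω - ξ (s i + h) ω)
      (fun ω (i : Fin n) => ξ (t i) ω - ξ (s i) ω) P P

/-- Increments over non-overlapping intervals are negatively correlated. -/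
def HasNegCorrIncrements {Ω : Type*} [MeasurableSpace Ω] (ξ : ℝ≥0 → Ω → ℝ)
    (P : Measure Ω) : Prop :=
  ∀ s t u v : ℝ≥0, s < t → t ≤ u → u < v →
    covariance (fun ω => ξ t ω - ξ s ω) (fun ω => ξ v ω - ξ u ω) P ≤ 0

/-- Increments over non-overlapping intervals are positively correlated. -/
def HasPosCorrIncrements {Ω : Type*} [MeasurableSpace Ω] (ξ : ℝ≥0 → Ω → ℝ)
    (P : Measure Ω) : Prop :=
  ∀ s t u v : ℝ≥0, s < t → t ≤ u → u < v →
    0 ≤ covariance (fun ω => ξ t ω - ξ s ω) (fun ω => ξ v ω - ξ u ω) P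

/-- Increments of the family `ψ` over non-overlapping intervals have disjoint supports. -/
def DisjointIncrements (ψ : ℝ≥0 → ℝ → ℝ) : Prop :=
  ∀ s t u v : ℝ≥0, s < t → t ≤ u → u < v →
    Disjoint (Function.support (ψ t - ψ s)) (Function.support (ψ v - ψ u))

/-- Either `t ↦ ψ_t(x)` is non-decreasing for all real `x`, or it is so for all `x ≥ 0` and every
`ψ_t` is odd. -/
def MonotoneOrOdd (ψ : ℝ≥0 → ℝ → ℝ) : Prop :=
  (∀ x : ℝ, Monotone fun t => ψ t x) ∨
  ((∀ x : ℝ, 0 ≤ x → Monotone fun t => ψ t x) ∧ ∀ (t : ℝ≥0) (x : ℝ), ψ t (-x) = -ψ t x)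

end DensityProcess

end

/-!
The covariance of `⟨X(1), f⟩` and `⟨X(1), g⟩` is, by the Chapman–Kolmogorov equation,
`m ∫ f g + (v - m) ∬ p_2(x - y) f(x) g(y) dx dy`, called `covForm` below. All parts of the result
are read off this bilinear form and three facts about the stable density.

* The density is non-negative and unimodal (`stableDensity_nonneg`, `stableDensity_anti`). With
  `a = α / 2`, the identity `u ^ a = c ∫₀^∞ (1 - e^{-l u}) l^{-1-a} dl` for `u = y ^ 2` shows that
  `e^{-t |y|^α}` is a limit of exponentials of Gaussian mixtures. Non-negativity and monotonicity
  in `|x|` of the cosine transform hold for Gaussians and are stable under mixtures, products with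
  Gaussians, sums and limits.
* `x^{1+α} p_t(x)` converges to an explicit constant (`tendsto_stableDensity`). After an
  integration by parts the limit is that of `∫₀^∞ z^{α-1} e^{-c z^α} sin z dz` as `c → 0`, which two
  further integrations by parts make absolutely convergent; the constant is positive for `α < 2`
  (`sineMoment_pos`).
* `p_t(x - y) dx dy` is a measure on the plane with Lebesgue marginals. Hence `covForm` is bounded on
  `L²(ℝ)`, so that `⟨X(1), ·⟩` extends to `L²(ℝ)` with values in centered jointly Gaussian random
  variables having covariance `covForm` (`isL2Extension_extPairing`, `hasGaussianLaw_pi`).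

Homogeneity is translation invariance of `covForm`, as the law of a centered Gaussian family is
determined by its covariance (`map_pi_eq`). Increments with disjoint supports have covariance
`(v - m) B`, where `B ≥ 0` because `p_2 ≥ 0` in the monotone case and because
`p_2(x - y) ≥ p_2(x + y)` for `x, y ≥ 0` in the odd case (`exists_covForm_increments`); for `v = m`
uncorrelated jointly Gaussian increments are independent. Long range dependence is the tail
asymptotics under dominated convergence (`tendsto_covForm_shift`). Path continuity is Kolmogorov's
dyadic chaining: boundedness of `covForm` bounds the variances of the increments by
`K |t - s|^β`, and Gaussian moments of high order give all exponents below `β / 2` at once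
(`exists_holder_version`).
-/

noncomputable section

namespace DensityProcess

/-! ### Gaussian mixtures, positivity and unimodality of the stable density -/

/-- The cosine transform of `φ`, regularized by a Gaussian factor. -/
def gaussCosTransform (φ : ℝ → ℝ) (ε x : ℝ) : ℝ :=
  ∫ y : ℝ, Real.cos (x * y) * (φ y * Real.exp (-ε * y ^ 2))

/-- Bounded symbols whose regularized cosine transforms are all non-negative and non-increasing
in the absolute value of the argument. The Gaussian factor makes all transforms converge, so that
no integrability has to be asked of the symbol itself. -/
structure IsUnimodalSymbol (φ : ℝ → ℝ) : Prop where
  measurable : Measurable φ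
  bounded : ∃ M : ℝ, ∀ y, |φ y| ≤ M
  nonneg : ∀ ε x : ℝ, 0 < ε → 0 ≤ gaussCosTransform φ ε x
  anti : ∀ ε x x' : ℝ, 0 < ε → |x| ≤ |x'| →
    gaussCosTransform φ ε x' ≤ gaussCosTransform φ ε x

lemma integrable_cos_mul {f : ℝ → ℝ} (hf : Integrable f) (x : ℝ) :
    Integrable fun y => Real.cos (x * y) * f y := by
  refine hf.bdd_mul (c := 1) (by fun_prop) (ae_of_all _ fun y => ?_)
  simpa using Real.abs_cos_le_one (x * y)

lemma integrable_bdd_mul_gauss {φ : ℝ → ℝ} (hφ : Measurable φ) {M : ℝ} (hM : ∀ y, |φ y| ≤ M)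
    {ε : ℝ} (hε : 0 < ε) : Integrable fun y : ℝ => φ y * Real.exp (-ε * y ^ 2) :=
  (integrable_exp_neg_mul_sq hε).bdd_mul (c := M) hφ.aestronglyMeasurable
    (ae_of_all _ fun y => by simpa using hM y)

/-- The symbol `1` is transformed into a centered Gaussian function, which is unimodal. -/
lemma gaussCosTransform_one {ε : ℝ} (hε : 0 < ε) (x : ℝ) :
    gaussCosTransform (fun _ => 1) ε x =
      (Real.pi / ε) ^ (1 / 2 : ℝ) * Real.exp (-x ^ 2 / (4 * ε)) := by
  have h := fourierIntegral_gaussian (b := (ε : ℂ)) (by simpa using hε) (x : ℂ)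
  have hint : Integrable fun y : ℝ =>
      Complex.exp (Complex.I * x * y) * Complex.exp (-(ε : ℂ) * (y : ℂ) ^ 2) := by
    have h0 : Integrable fun y : ℝ => ((Real.exp (-ε * y ^ 2) : ℝ) : ℂ) :=
      (integrable_exp_neg_mul_sq hε).ofReal
    have := h0.bdd_mul (c := 1) (f := fun y : ℝ => Complex.exp (Complex.I * x * y))
      (by fun_prop) (ae_of_all _ fun y => by
        rw [show Complex.I * (x : ℂ) * (y : ℂ) = ((x * y : ℝ) : ℂ) * Complex.I by push_cast; ring,
          Complex.norm_exp_ofReal_mul_I])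
    refine this.congr (ae_of_all _ fun y => ?_)
    simp
  have h2 := congrArg Complex.re h
  rw [← RCLike.re_eq_complex_re, ← integral_re hint] at h2
  have h3 : ∀ y : ℝ, RCLike.re (Complex.exp (Complex.I * x * y) *
      Complex.exp (-(ε : ℂ) * (y : ℂ) ^ 2)) = Real.cos (x * y) * (1 * Real.exp (-ε * y ^ 2)) := by
    intro y
    rw [show Complex.I * (x : ℂ) * (y : ℂ) = ((x * y : ℝ) : ℂ) * Complex.I by push_cast; ring,
      show -(ε : ℂ) * (y : ℂ) ^ 2 = ((-ε * y ^ 2 : ℝ) : ℂ) by push_cast; ring,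
      ← Complex.ofReal_exp, RCLike.re_eq_complex_re, Complex.re_mul_ofReal,
      Complex.exp_ofReal_mul_I_re, one_mul]
  simp only [h3] at h2
  rw [gaussCosTransform, h2, RCLike.re_eq_complex_re,
    show ((Real.pi : ℂ) / ε) ^ (1 / 2 : ℂ) = (((Real.pi / ε) ^ (1 / 2 : ℝ) : ℝ) : ℂ) by
      rw [Complex.ofReal_cpow (by positivity)]; push_cast; rfl,
    show -(x : ℂ) ^ 2 / (4 * ε) = ((-x ^ 2 / (4 * ε) : ℝ) : ℂ) by push_cast; rfl,
    ← Complex.ofReal_exp, ← Complex.ofReal_mul, Complex.ofReal_re]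

namespace IsUnimodalSymbol

lemma one : IsUnimodalSymbol fun _ => 1 where
  measurable := measurable_const
  bounded := ⟨1, fun _ => by simp⟩
  nonneg ε x hε := by
    rw [gaussCosTransform_one hε]; positivity
  anti ε x x' hε h := by
    rw [gaussCosTransform_one hε, gaussCosTransform_one hε]
    have : x ^ 2 ≤ x' ^ 2 := sq_le_sq.2 h
    gcongr

/-- Unimodality passes to bounded pointwise limits, by dominated convergence. -/
lemma of_tendsto {F : ℕ → ℝ → ℝ} {φ : ℝ → ℝ} {M : ℝ} (hF : ∀ n, IsUnimodalSymbol (F n))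
    (hM : ∀ n y, |F n y| ≤ M) (hlim : ∀ y, Tendsto (fun n => F n y) atTop (𝓝 (φ y))) :
    IsUnimodalSymbol φ := by
  have hm : Measurable φ := measurable_of_tendsto_metrizable (fun n => (hF n).measurable)
    (tendsto_pi_nhds.2 hlim)
  have key : ∀ ε x : ℝ, 0 < ε → Tendsto (fun n => gaussCosTransform (F n) ε x) atTop
      (𝓝 (gaussCosTransform φ ε x)) := by
    intro ε x hε
    refine tendsto_integral_of_dominated_convergence (fun y => M * Real.exp (-ε * y ^ 2))
      (fun n => ?_) ((integrable_exp_neg_mul_sq hε).const_mul M) (fun n => ae_of_all _ fun y => ?_)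
      (ae_of_all _ fun y => ?_)
    · have := (hF n).measurable
      exact Measurable.aestronglyMeasurable (by fun_prop)
    · rw [Real.norm_eq_abs, abs_mul, abs_mul, abs_of_pos (Real.exp_pos _)]
      have h1 := Real.abs_cos_le_one (x * y)
      have h2 := hM n y
      have h3 := (Real.exp_pos (-ε * y ^ 2)).le
      calc |Real.cos (x * y)| * (|F n y| * Real.exp (-ε * y ^ 2))
          ≤ 1 * (M * Real.exp (-ε * y ^ 2)) := by gcongr
        _ = _ := one_mul _
    · exact ((hlim y).mul_const _).const_mul _
  refine ⟨hm, ⟨M, fun y => le_of_tendsto (hlim y).abs (Eventually.of_forall fun n => hM n y)⟩,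
    fun ε x hε => ge_of_tendsto' (key ε x hε) fun n => (hF n).nonneg ε x hε,
    fun ε x x' hε h => le_of_tendsto_of_tendsto' (key ε x' hε) (key ε x hε)
      fun n => (hF n).anti ε x x' hε h⟩

lemma const_mul {φ : ℝ → ℝ} (hφ : IsUnimodalSymbol φ) {c : ℝ} (hc : 0 ≤ c) :
    IsUnimodalSymbol fun y => c * φ y := by
  have key : ∀ ε x : ℝ, gaussCosTransform (fun y => c * φ y) ε x = c * gaussCosTransform φ ε x := by
    intro ε x
    rw [gaussCosTransform, gaussCosTransform, ← integral_const_mul]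
    congr 1 with y
    ring
  obtain ⟨M, hM⟩ := hφ.bounded
  refine ⟨hφ.measurable.const_mul c, ⟨c * M, fun y => ?_⟩, fun ε x hε => ?_, fun ε x x' hε h => ?_⟩
  · rw [abs_mul, abs_of_nonneg hc]
    exact mul_le_mul_of_nonneg_left (hM y) hc
  · rw [key]; exact mul_nonneg hc (hφ.nonneg ε x hε)
  · rw [key, key]; exact mul_le_mul_of_nonneg_left (hφ.anti ε x x' hε h) hc

lemma add {φ ψ : ℝ → ℝ} (hφ : IsUnimodalSymbol φ) (hψ : IsUnimodalSymbol ψ) :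
    IsUnimodalSymbol fun y => φ y + ψ y := by
  obtain ⟨M, hM⟩ := hφ.bounded
  obtain ⟨N, hN⟩ := hψ.bounded
  have key : ∀ ε x : ℝ, 0 < ε → gaussCosTransform (fun y => φ y + ψ y) ε x =
      gaussCosTransform φ ε x + gaussCosTransform ψ ε x := by
    intro ε x hε
    rw [gaussCosTransform, gaussCosTransform, gaussCosTransform,
      ← integral_add (integrable_cos_mul (integrable_bdd_mul_gauss hφ.measurable hM hε) x)
        (integrable_cos_mul (integrable_bdd_mul_gauss hψ.measurable hN hε) x)]
    congr 1 with y
    ring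
  refine ⟨hφ.measurable.add hψ.measurable, ⟨M + N, fun y => ?_⟩, fun ε x hε => ?_,
    fun ε x x' hε h => ?_⟩
  · exact (abs_add_le _ _).trans (add_le_add (hM y) (hN y))
  · rw [key _ _ hε]; exact add_nonneg (hφ.nonneg ε x hε) (hψ.nonneg ε x hε)
  · rw [key _ _ hε, key _ _ hε]; exact add_le_add (hφ.anti ε x x' hε h) (hψ.anti ε x x' hε h)

/-- A Gaussian factor is absorbed into the regularization parameter. -/
lemma mul_gauss {φ : ℝ → ℝ} (hφ : IsUnimodalSymbol φ) {l : ℝ} (hl : 0 ≤ l) :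
    IsUnimodalSymbol fun y => φ y * Real.exp (-l * y ^ 2) := by
  have key : ∀ ε x : ℝ, gaussCosTransform (fun y => φ y * Real.exp (-l * y ^ 2)) ε x =
      gaussCosTransform φ (l + ε) x := by
    intro ε x
    rw [gaussCosTransform, gaussCosTransform]
    congr 1 with y
    rw [mul_assoc (φ y), ← Real.exp_add]
    congr 3
    ring
  obtain ⟨M, hM⟩ := hφ.bounded
  have hm := hφ.measurable
  refine ⟨by fun_prop, ⟨M, fun y => ?_⟩, fun ε x hε => ?_, fun ε x x' hε h => ?_⟩
  · rw [abs_mul, abs_of_pos (Real.exp_pos _)]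
    have h1 : Real.exp (-l * y ^ 2) ≤ 1 := by
      rw [Real.exp_le_one_iff]
      have : 0 ≤ l * y ^ 2 := by positivity
      linarith
    calc |φ y| * Real.exp (-l * y ^ 2) ≤ |φ y| * 1 := by gcongr
      _ ≤ M := by simpa using hM y
  · rw [key]; exact hφ.nonneg _ x (by linarith)
  · rw [key, key]; exact hφ.anti _ x x' (by linarith) h

/-- Multiplication by a mixture of Gaussian symbols: the regularized transform of the product is
the mixture of those with a larger regularization parameter. -/
lemma mul_mixture {φ : ℝ → ℝ} (hφ : IsUnimodalSymbol φ) {ν : Measure ℝ} [IsFiniteMeasure ν]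
    (hν : ∀ᵐ l ∂ν, 0 ≤ l) :
    IsUnimodalSymbol fun y => φ y * ∫ l, Real.exp (-l * y ^ 2) ∂ν := by
  obtain ⟨M, hM⟩ := hφ.bounded
  have hM0 : 0 ≤ M := (abs_nonneg _).trans (hM 0)
  have hm := hφ.measurable
  have hg : Measurable fun y : ℝ => ∫ l, Real.exp (-l * y ^ 2) ∂ν :=
    (StronglyMeasurable.integral_prod_right
      (f := fun y l : ℝ => Real.exp (-l * y ^ 2)) (by
        exact Measurable.stronglyMeasurable (by fun_prop))).measurable
  have hle : ∀ y : ℝ, ∀ᵐ l ∂ν, Real.exp (-l * y ^ 2) ≤ 1 := by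
    intro y
    filter_upwards [hν] with l hl
    rw [Real.exp_le_one_iff]
    have : 0 ≤ l * y ^ 2 := by positivity
    linarith
  have hint : ∀ ε x : ℝ, 0 < ε → Integrable (fun z : ℝ × ℝ =>
      Real.cos (x * z.1) * (φ z.1 * Real.exp (-z.2 * z.1 ^ 2) * Real.exp (-ε * z.1 ^ 2)))
      ((volume : Measure ℝ).prod ν) := by
    intro ε x hε
    have h0 : Integrable (fun z : ℝ × ℝ => (M * Real.exp (-ε * z.1 ^ 2)) * 1)
        ((volume : Measure ℝ).prod ν) :=
      Integrable.mul_prod (f := fun y : ℝ => M * Real.exp (-ε * y ^ 2)) (g := fun _ => (1 : ℝ))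
        ((integrable_exp_neg_mul_sq hε).const_mul M) (integrable_const _)
    refine h0.mono' (Measurable.aestronglyMeasurable (by fun_prop)) ?_
    have hν' : ∀ᵐ z ∂((volume : Measure ℝ).prod ν), 0 ≤ z.2 :=
      Measure.quasiMeasurePreserving_snd.ae hν
    filter_upwards [hν'] with z hz
    rw [Real.norm_eq_abs, abs_mul, abs_mul, abs_mul, abs_of_pos (Real.exp_pos _),
      abs_of_pos (Real.exp_pos _), mul_one]
    have h1 : Real.exp (-z.2 * z.1 ^ 2) ≤ 1 := by
      rw [Real.exp_le_one_iff]
      have : 0 ≤ z.2 * z.1 ^ 2 := by positivity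
      linarith
    calc |Real.cos (x * z.1)| * (|φ z.1| * Real.exp (-z.2 * z.1 ^ 2) * Real.exp (-ε * z.1 ^ 2))
        ≤ 1 * (M * 1 * Real.exp (-ε * z.1 ^ 2)) := by
          gcongr
          · exact Real.abs_cos_le_one _
          · exact hM _
      _ = _ := by ring
  have key : ∀ ε x : ℝ, 0 < ε →
      gaussCosTransform (fun y => φ y * ∫ l, Real.exp (-l * y ^ 2) ∂ν) ε x =
        ∫ l, gaussCosTransform (fun y => φ y * Real.exp (-l * y ^ 2)) ε x ∂ν := by
    intro ε x hε
    unfold gaussCosTransform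
    rw [← integral_integral_swap (μ := (volume : Measure ℝ)) (ν := ν)
      (f := fun y l => Real.cos (x * y) * (φ y * Real.exp (-l * y ^ 2) * Real.exp (-ε * y ^ 2)))
      (hint ε x hε)]
    congr 1 with y
    rw [integral_const_mul, integral_mul_const, integral_const_mul]
  have key2 : ∀ ε x : ℝ, 0 < ε →
      Integrable (fun l => gaussCosTransform (fun y => φ y * Real.exp (-l * y ^ 2)) ε x) ν :=
    fun ε x hε => (hint ε x hε).integral_prod_right
  refine ⟨hm.mul hg, ⟨M * ν.real Set.univ, fun y => ?_⟩, fun ε x hε => ?_, fun ε x x' hε h => ?_⟩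
  · rw [abs_mul]
    refine mul_le_mul (hM y) ?_ (abs_nonneg _) hM0
    have := norm_integral_le_of_norm_le_const (μ := ν) (f := fun l => Real.exp (-l * y ^ 2))
      (C := 1) (by
        filter_upwards [hle y] with l hl
        rwa [Real.norm_eq_abs, abs_of_pos (Real.exp_pos _)])
    simpa using this
  · rw [key _ _ hε]
    exact integral_nonneg_of_ae (by
      filter_upwards [hν] with l hl using (hφ.mul_gauss hl).nonneg ε x hε)
  · rw [key _ _ hε, key _ _ hε]
    refine integral_mono_ae (key2 _ _ hε) (key2 _ _ hε) ?_
    filter_upwards [hν] with l hl using (hφ.mul_gauss hl).anti ε x x' hε h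

/-- By the exponential series. Up to the factor `e^{-s ν(ℝ)}` this is the characteristic function of
a compound Poisson law whose jumps are mixtures of centered Gaussians. -/
lemma exp_mixture {ν : Measure ℝ} [IsFiniteMeasure ν] (hν : ∀ᵐ l ∂ν, 0 ≤ l) {s : ℝ}
    (hs : 0 ≤ s) :
    IsUnimodalSymbol fun y => Real.exp (s * ∫ l, Real.exp (-l * y ^ 2) ∂ν) := by
  set g : ℝ → ℝ := fun y => ∫ l, Real.exp (-l * y ^ 2) ∂ν with hg
  have hpow : ∀ n : ℕ, IsUnimodalSymbol fun y => g y ^ n := by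
    intro n
    induction n with
    | zero => simpa using one
    | succ n ih =>
      have h := ih.mul_mixture hν
      rwa [show (fun y => g y ^ n * ∫ l, Real.exp (-l * y ^ 2) ∂ν) = fun y => g y ^ (n + 1) from
        funext fun y => (pow_succ (g y) n).symm] at h
  obtain ⟨M, hM⟩ := (hpow 1).bounded
  simp only [pow_one] at hM
  have hg0 : ∀ y, 0 ≤ g y := fun y => integral_nonneg fun l => (Real.exp_pos _).le
  have hsum : ∀ n : ℕ, IsUnimodalSymbol fun y =>
      ∑ k ∈ Finset.range n, (s ^ k / (k.factorial : ℝ)) * g y ^ k := by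
    intro n
    induction n with
    | zero => simpa using one.const_mul (le_refl (0 : ℝ))
    | succ n ih =>
      simp only [Finset.sum_range_succ]
      exact ih.add ((hpow n).const_mul (by positivity))
  have hexp : ∀ y, ∀ n : ℕ, (∑ k ∈ Finset.range n, (s ^ k / (k.factorial : ℝ)) * g y ^ k) =
      ∑ k ∈ Finset.range n, (s * g y) ^ k / (k.factorial : ℝ) := by
    intro y n
    refine Finset.sum_congr rfl fun k _ => ?_
    rw [mul_pow]; ring
  refine of_tendsto (M := Real.exp (s * M)) hsum (fun n y => ?_) fun y => ?_
  · rw [hexp, abs_of_nonneg (Finset.sum_nonneg fun k _ => by have := hg0 y; positivity)]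
    refine (Real.sum_le_exp_of_nonneg (mul_nonneg hs (hg0 y)) n).trans ?_
    have := (le_abs_self _).trans (hM y)
    gcongr
  · simp only [hexp]
    have := (NormedSpace.expSeries_div_hasSum_exp (𝔸 := ℝ) (s * g y)).tendsto_sum_nat
    rwa [← Real.exp_eq_exp_ℝ] at this

end IsUnimodalSymbol

lemma one_sub_exp_neg_nonneg {l u : ℝ} (hl : 0 ≤ l) (hu : 0 ≤ u) : 0 ≤ 1 - Real.exp (-l * u) := by
  have : Real.exp (-l * u) ≤ 1 := by
    rw [Real.exp_le_one_iff]
    have := mul_nonneg hl hu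
    linarith
  linarith

lemma integrableOn_one_sub_exp_mul_rpow {a : ℝ} (ha0 : 0 < a) (ha1 : a < 1) {u : ℝ} (hu : 0 ≤ u) :
    IntegrableOn (fun l : ℝ => (1 - Real.exp (-l * u)) * l ^ (-1 - a)) (Set.Ioi 0) := by
  have hmeas : ∀ s : Set ℝ, AEStronglyMeasurable
      (fun l : ℝ => (1 - Real.exp (-l * u)) * l ^ (-1 - a)) (volume.restrict s) :=
    fun s => Measurable.aestronglyMeasurable (by fun_prop)
  rw [← Set.Ioc_union_Ioi_eq_Ioi (zero_le_one' ℝ), integrableOn_union]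
  constructor
  · have h1 : IntegrableOn (fun l : ℝ => u * l ^ (-a)) (Set.Ioc 0 1) := by
      have := intervalIntegral.intervalIntegrable_rpow' (a := 0) (b := 1) (r := -a) (by linarith)
      rw [intervalIntegrable_iff_integrableOn_Ioc_of_le zero_le_one] at this
      exact this.const_mul u
    refine Integrable.mono' h1 (hmeas _) ?_
    filter_upwards [ae_restrict_mem measurableSet_Ioc] with l hl
    have hl0 : 0 < l := hl.1
    rw [Real.norm_eq_abs, abs_of_nonneg (mul_nonneg (one_sub_exp_neg_nonneg hl0.le hu)
      (Real.rpow_nonneg hl0.le _))]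
    have h2 : 1 - Real.exp (-l * u) ≤ u * l := by
      have := Real.add_one_le_exp (-l * u)
      linarith
    calc (1 - Real.exp (-l * u)) * l ^ (-1 - a) ≤ (u * l) * l ^ (-1 - a) :=
          mul_le_mul_of_nonneg_right h2 (Real.rpow_nonneg hl0.le _)
      _ = u * l ^ (-a) := by
          rw [mul_assoc, ← Real.rpow_one_add' hl0.le (by linarith)]
          congr 2
          ring
  · refine Integrable.mono' (integrableOn_Ioi_rpow_of_lt (a := -1 - a) (by linarith) zero_lt_one)
      (hmeas _) ?_
    filter_upwards [ae_restrict_mem measurableSet_Ioi] with l hl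
    have hl0 : (0 : ℝ) < l := zero_lt_one.trans hl
    rw [Real.norm_eq_abs, abs_of_nonneg (mul_nonneg (one_sub_exp_neg_nonneg hl0.le hu)
      (Real.rpow_nonneg hl0.le _))]
    have h2 : 1 - Real.exp (-l * u) ≤ 1 := by
      have := Real.exp_pos (-l * u)
      linarith
    calc (1 - Real.exp (-l * u)) * l ^ (-1 - a) ≤ 1 * l ^ (-1 - a) :=
          mul_le_mul_of_nonneg_right h2 (Real.rpow_nonneg hl0.le _)
      _ = l ^ (-1 - a) := one_mul _

/-- The constant `∫₀^∞ (1 - e^{-l}) l^{-1-a} dl` in the representation of `u ^ a` as a mixture of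
the functions `1 - e^{-l u}`. -/
def bernsteinConst (a : ℝ) : ℝ :=
  ∫ l in Set.Ioi (0 : ℝ), (1 - Real.exp (-l * 1)) * l ^ (-1 - a)

lemma bernsteinConst_pos {a : ℝ} (ha0 : 0 < a) (ha1 : a < 1) : 0 < bernsteinConst a := by
  rw [bernsteinConst, setIntegral_pos_iff_support_of_nonneg_ae]
  · rw [Set.inter_eq_right.2]
    · simp
    · intro l hl
      have hl0 : (0 : ℝ) < l := hl
      have h1 : Real.exp (-l * 1) < 1 := by
        rw [Real.exp_lt_one_iff]
        linarith
      exact (mul_pos (by linarith) (Real.rpow_pos_of_pos hl0 _)).ne'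
  · filter_upwards [ae_restrict_mem measurableSet_Ioi] with l hl
    have hl0 : (0 : ℝ) < l := hl
    exact mul_nonneg (one_sub_exp_neg_nonneg hl0.le zero_le_one) (Real.rpow_nonneg hl0.le _)
  · exact integrableOn_one_sub_exp_mul_rpow ha0 ha1 zero_le_one

/-- The Bernstein representation of `u ^ a`, by the substitution `l ↦ u l`. -/
lemma integral_one_sub_exp_mul_rpow {a : ℝ} (ha0 : 0 < a) {u : ℝ} (hu : 0 ≤ u) :
    ∫ l in Set.Ioi (0 : ℝ), (1 - Real.exp (-l * u)) * l ^ (-1 - a) =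
      bernsteinConst a * u ^ a := by
  rcases hu.eq_or_lt with rfl | hu
  · simp [Real.zero_rpow ha0.ne']
  have h := integral_comp_mul_left_Ioi
    (fun l : ℝ => (1 - Real.exp (-l * 1)) * l ^ (-1 - a)) 0 hu
  rw [mul_zero, smul_eq_mul] at h
  have h2 : ∫ x in Set.Ioi (0 : ℝ), (1 - Real.exp (-(u * x) * 1)) * (u * x) ^ (-1 - a) =
      u ^ (-1 - a) * ∫ l in Set.Ioi (0 : ℝ), (1 - Real.exp (-l * u)) * l ^ (-1 - a) := by
    rw [← integral_const_mul]
    refine setIntegral_congr_fun measurableSet_Ioi fun x hx => ?_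
    have hx0 : (0 : ℝ) < x := hx
    rw [Real.mul_rpow hu.le hx0.le, show -(u * x) * 1 = -x * u by ring]
    ring
  rw [h2] at h
  have h3 : u ^ (-1 - a) * (u ^ a * u) = 1 := by
    rw [← Real.rpow_add_one hu.ne', ← Real.rpow_add hu,
      show -1 - a + (a + 1) = 0 by ring, Real.rpow_zero]
  have h4 : (u ^ a * u) * (u ^ (-1 - a) *
      ∫ l in Set.Ioi (0 : ℝ), (1 - Real.exp (-l * u)) * l ^ (-1 - a)) =
      (u ^ a * u) * (u⁻¹ * bernsteinConst a) := by rw [h]; rfl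
  rw [← mul_assoc, mul_comm (u ^ a * u), h3, one_mul] at h4
  rw [h4]
  field_simp

/-- For `α < 2`, the Bernstein representation of `(y ^ 2) ^ (α / 2)`, cut off at small `l`, exhibits
`exp (-t |y| ^ α)` as a limit of multiples of exponentials of Gaussian mixtures. -/
lemma isUnimodalSymbol_stable {α : ℝ} (hα0 : 0 < α) (hα2 : α ≤ 2) {t : ℝ} (ht : 0 < t) :
    IsUnimodalSymbol fun y => Real.exp (-(t * |y| ^ α)) := by
  rcases hα2.eq_or_lt with rfl | hα2
  · have := IsUnimodalSymbol.one.mul_gauss ht.le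
    simpa using this
  -- `|y| ^ α = (y ^ 2) ^ a`, and the density `l ^ (-1 - a)` has finite mass away from zero
  set a := α / 2 with ha
  have ha0 : 0 < a := by positivity
  have ha1 : a < 1 := by rw [ha]; linarith
  have hκ := bernsteinConst_pos ha0 ha1
  set κ := bernsteinConst a with hκdef
  have hya : ∀ y : ℝ, (y ^ 2) ^ a = |y| ^ α := by
    intro y
    rw [← sq_abs, ← Real.rpow_natCast, ← Real.rpow_mul (abs_nonneg y)]
    congr 1
    rw [ha]; push_cast; ring
  let δ : ℕ → ℝ := fun n => 1 / ((n : ℝ) + 1)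
  have hδ : ∀ n, 0 < δ n := fun n => by positivity
  have hδlim : Tendsto δ atTop (𝓝 0) := tendsto_one_div_add_atTop_nhds_zero_nat
  let ν : ℕ → Measure ℝ := fun n =>
    (volume.restrict (Set.Ioi (δ n))).withDensity fun l => ENNReal.ofReal (l ^ (-1 - a))
  have hdens : ∀ n, IntegrableOn (fun l : ℝ => l ^ (-1 - a)) (Set.Ioi (δ n)) := fun n =>
    integrableOn_Ioi_rpow_of_lt (by linarith) (hδ n)
  have hfin : ∀ n, IsFiniteMeasure (ν n) := fun n =>
    isFiniteMeasure_withDensity_ofReal (hdens n).2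
  have hpos : ∀ n, ∀ᵐ l ∂(ν n), 0 ≤ l := fun n => by
    refine (withDensity_absolutelyContinuous _ _).ae_le ?_
    filter_upwards [ae_restrict_mem measurableSet_Ioi] with l hl using ((hδ n).trans hl).le
  have hcalc : ∀ (n : ℕ) (f : ℝ → ℝ),
      ∫ l, f l ∂(ν n) = ∫ l in Set.Ioi (δ n), f l * l ^ (-1 - a) := by
    intro n f
    rw [integral_withDensity_eq_integral_toReal_smul (by fun_prop)
      (ae_of_all _ fun _ => ENNReal.ofReal_lt_top)]
    refine setIntegral_congr_fun measurableSet_Ioi fun l hl => ?_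
    have hl0 : 0 < l := (hδ n).trans hl
    rw [smul_eq_mul]
    rw [ENNReal.toReal_ofReal (Real.rpow_nonneg hl0.le _), mul_comm]
  let F : ℕ → ℝ → ℝ := fun n y => Real.exp (-(t / κ) *
    ∫ l in Set.Ioi (δ n), (1 - Real.exp (-l * y ^ 2)) * l ^ (-1 - a))
  have hF : ∀ n, IsUnimodalSymbol (F n) := by
    intro n
    have := hfin n
    have h1 := (IsUnimodalSymbol.exp_mixture (hpos n) (s := t / κ) (by positivity)).const_mul
      (c := Real.exp (-(t / κ) * (ν n).real Set.univ)) (Real.exp_pos _).le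
    convert h1 using 2 with y
    rw [← Real.exp_add]
    have h2 := hcalc n fun l => 1 - Real.exp (-l * y ^ 2)
    simp only [F]
    rw [← h2, integral_sub (integrable_const _), integral_const, smul_eq_mul, mul_one, mul_sub,
      neg_mul, neg_mul, sub_neg_eq_add]
    refine (integrable_const (1 : ℝ)).mono' (by fun_prop) ?_
    filter_upwards [hpos n] with l hl
    have := one_sub_exp_neg_nonneg hl (sq_nonneg y)
    rw [Real.norm_eq_abs, abs_of_pos (Real.exp_pos _)]
    linarith
  refine IsUnimodalSymbol.of_tendsto (M := 1) hF (fun n y => ?_) fun y => ?_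
  · rw [abs_of_pos (Real.exp_pos _), Real.exp_le_one_iff, neg_mul, neg_nonpos]
    refine mul_nonneg (by positivity) (setIntegral_nonneg measurableSet_Ioi fun l hl => ?_)
    have hl0 : 0 < l := (hδ n).trans hl
    exact mul_nonneg (one_sub_exp_neg_nonneg hl0.le (sq_nonneg y)) (Real.rpow_nonneg hl0.le _)
  · have h1 := integral_one_sub_exp_mul_rpow (a := a) ha0 (sq_nonneg y)
    have hint := integrableOn_one_sub_exp_mul_rpow ha0 ha1 (sq_nonneg y)
    have h2 := (aecover_Ioi_of_Ioi (μ := volume) hδlim).integral_tendsto_of_countably_generated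
      hint
    rw [h1, hya] at h2
    have h3 : ∀ n, ∫ l in Set.Ioi (δ n), (1 - Real.exp (-l * y ^ 2)) * l ^ (-1 - a)
        ∂(volume.restrict (Set.Ioi 0)) =
        ∫ l in Set.Ioi (δ n), (1 - Real.exp (-l * y ^ 2)) * l ^ (-1 - a) := by
      intro n
      rw [Measure.restrict_restrict measurableSet_Ioi,
        Set.inter_eq_left.2 (Set.Ioi_subset_Ioi (hδ n).le)]
    simp only [h3] at h2
    have h4 := (Real.continuous_exp.tendsto _).comp (h2.const_mul (-(t / κ)))
    convert h4 using 2
    congr 1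
    rw [← hκdef]
    field_simp

lemma integrable_exp_neg_mul_abs_rpow {α t : ℝ} (hα : 0 < α) (ht : 0 < t) :
    Integrable fun y : ℝ => Real.exp (-(t * |y| ^ α)) := by
  have h := integrableOn_rpow_mul_exp_neg_mul_rpow (p := α) (s := 0) (b := t)
    (by norm_num) hα ht
  have h2 : IntegrableOn (fun y : ℝ => Real.exp (-(t * |y| ^ α))) (Set.Ioi 0) := by
    refine h.congr_fun (fun y hy => ?_) measurableSet_Ioi
    have hy0 : (0 : ℝ) < y := hy
    beta_reduce
    rw [Real.rpow_zero, one_mul, abs_of_pos hy0, neg_mul]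
  rw [← integrableOn_univ, ← Set.Iic_union_Ioi (a := (0 : ℝ)), integrableOn_union]
  refine ⟨?_, h2⟩
  rw [integrableOn_Iic_iff_integrableOn_Iio]
  have := h2.comp_neg
  simpa using this

lemma tendsto_gaussCosTransform_stable {α t : ℝ} (hα : 0 < α) (ht : 0 < t) (x : ℝ) :
    Tendsto (fun n : ℕ => gaussCosTransform (fun y => Real.exp (-(t * |y| ^ α)))
      (1 / ((n : ℝ) + 1)) x) atTop
      (𝓝 (∫ y : ℝ, Real.cos (x * y) * Real.exp (-(t * |y| ^ α)))) := by
  refine tendsto_integral_of_dominated_convergence _ (fun n => ?_)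
    (integrable_exp_neg_mul_abs_rpow hα ht) (fun n => ae_of_all _ fun y => ?_)
    (ae_of_all _ fun y => ?_)
  · exact Measurable.aestronglyMeasurable (by fun_prop)
  · rw [Real.norm_eq_abs, abs_mul, abs_mul, abs_of_pos (Real.exp_pos _),
      abs_of_pos (Real.exp_pos _)]
    have h1 : Real.exp (-(1 / ((n : ℝ) + 1)) * y ^ 2) ≤ 1 := by
      rw [Real.exp_le_one_iff, neg_mul, neg_nonpos]
      positivity
    calc _ ≤ 1 * (Real.exp (-(t * |y| ^ α)) * 1) := by
          gcongr
          exact Real.abs_cos_le_one _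
      _ = _ := by ring
  · have h1 : Tendsto (fun n : ℕ => Real.exp (-(1 / ((n : ℝ) + 1)) * y ^ 2)) atTop (𝓝 1) := by
      have := (tendsto_one_div_add_atTop_nhds_zero_nat (𝕜 := ℝ)).neg.mul_const (y ^ 2)
      have := (Real.continuous_exp.tendsto _).comp this
      simpa [Function.comp_def] using this
    simpa using (h1.const_mul (Real.exp (-(t * |y| ^ α)))).const_mul (Real.cos (x * y))

lemma stableDensity_nonneg {α t : ℝ} (hα0 : 0 < α) (hα2 : α ≤ 2) (ht : 0 < t) (x : ℝ) :
    0 ≤ stableDensity α t x := by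
  refine mul_nonneg (by positivity) ?_
  exact ge_of_tendsto' (tendsto_gaussCosTransform_stable hα0 ht x) fun n =>
    (isUnimodalSymbol_stable hα0 hα2 ht).nonneg _ x (by positivity)

/-- The symmetric stable density is unimodal. -/
lemma stableDensity_anti {α t : ℝ} (hα0 : 0 < α) (hα2 : α ≤ 2) (ht : 0 < t) {x x' : ℝ}
    (h : |x| ≤ |x'|) : stableDensity α t x' ≤ stableDensity α t x := by
  refine mul_le_mul_of_nonneg_left ?_ (by positivity)
  exact le_of_tendsto_of_tendsto' (tendsto_gaussCosTransform_stable hα0 ht x')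
    (tendsto_gaussCosTransform_stable hα0 ht x) fun n =>
    (isUnimodalSymbol_stable hα0 hα2 ht).anti _ x x' (by positivity) h

lemma stableDensity_neg (α t x : ℝ) : stableDensity α t (-x) = stableDensity α t x := by
  simp [stableDensity]

lemma continuous_stableDensity {α t : ℝ} (hα : 0 < α) (ht : 0 < t) :
    Continuous (stableDensity α t) := by
  refine continuous_const.mul ?_
  refine continuous_of_dominated (bound := fun y => Real.exp (-(t * |y| ^ α))) (fun x => ?_)
    (fun x => ae_of_all _ fun y => ?_) (integrable_exp_neg_mul_abs_rpow hα ht)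
    (ae_of_all _ fun y => by fun_prop)
  · exact Measurable.aestronglyMeasurable (by fun_prop)
  · rw [Real.norm_eq_abs, abs_mul, abs_of_pos (Real.exp_pos _)]
    exact mul_le_of_le_one_left (Real.exp_pos _).le (Real.abs_cos_le_one _)

/-! ### An oscillatory integral -/

/-- The function `z ↦ z ^ s * exp (-c z ^ b)`. -/
def dampedPow (b c s z : ℝ) : ℝ := z ^ s * Real.exp (-c * z ^ b)

lemma dampedPow_nonneg (b c s : ℝ) {z : ℝ} (hz : 0 ≤ z) : 0 ≤ dampedPow b c s z :=
  mul_nonneg (Real.rpow_nonneg hz _) (Real.exp_pos _).le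

lemma measurable_dampedPow (b c s : ℝ) : Measurable (dampedPow b c s) := by
  unfold dampedPow; fun_prop

lemma hasDerivAt_dampedPow (b c s : ℝ) {z : ℝ} (hz : 0 < z) :
    HasDerivAt (dampedPow b c s)
      (s * dampedPow b c (s - 1) z - c * b * dampedPow b c (s + b - 1) z) z := by
  have h1 := Real.hasDerivAt_rpow_const (x := z) (p := s) (Or.inl hz.ne')
  have h2 := ((Real.hasDerivAt_rpow_const (x := z) (p := b) (Or.inl hz.ne')).const_mul (-c)).exp
  refine (h1.mul h2).congr_deriv ?_
  rw [dampedPow, dampedPow, show s + b - 1 = s + (b - 1) by ring, Real.rpow_add hz]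
  ring

lemma tendsto_dampedPow_atTop {b c : ℝ} (hb : 0 < b) (hc : 0 < c) (s : ℝ) :
    Tendsto (dampedPow b c s) atTop (𝓝 0) := by
  have h := (tendsto_rpow_mul_exp_neg_mul_atTop_nhds_zero (s / b) c hc).comp
    (tendsto_rpow_atTop hb)
  refine h.congr' ?_
  filter_upwards [eventually_gt_atTop 0] with z hz
  simp only [Function.comp_apply]
  rw [← Real.rpow_mul hz.le, mul_div_cancel₀ _ hb.ne', dampedPow]

lemma integrableOn_dampedPow_Ioi_zero {b c s : ℝ} (hb : 0 < b) (hc : 0 < c) (hs : -1 < s) :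
    IntegrableOn (dampedPow b c s) (Set.Ioi 0) :=
  integrableOn_rpow_mul_exp_neg_mul_rpow hs hb hc

lemma integrableOn_dampedPow {b c : ℝ} (hb : 0 < b) (hc : 0 < c) (s : ℝ) :
    IntegrableOn (dampedPow b c s) (Set.Ioi 1) := by
  have h := (integrableOn_dampedPow_Ioi_zero hb hc (s := max s 0)
    (by linarith [le_max_right s 0])).mono_set (Set.Ioi_subset_Ioi zero_le_one)
  refine Integrable.mono' h (measurable_dampedPow b c s).aestronglyMeasurable ?_
  filter_upwards [ae_restrict_mem measurableSet_Ioi] with z hz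
  have hz1 : (1 : ℝ) < z := hz
  rw [Real.norm_eq_abs, abs_of_nonneg (dampedPow_nonneg _ _ _ (by linarith))]
  exact mul_le_mul_of_nonneg_right (Real.rpow_le_rpow_of_exponent_le hz1.le (le_max_left _ _))
    (Real.exp_pos _).le

lemma dampedPow_le {b c s z : ℝ} (hc : 0 ≤ c) (hz : 0 ≤ z) : dampedPow b c s z ≤ z ^ s := by
  refine mul_le_of_le_one_right (Real.rpow_nonneg hz _) ?_
  rw [Real.exp_le_one_iff, neg_mul, neg_nonpos]
  exact mul_nonneg hc (Real.rpow_nonneg hz _)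

/-- A bound uniform in `c`, as `w e^{-w}` is bounded. Together with the next lemma it dominates the
second derivative of `dampedPow` as `c` tends to zero. -/
lemma mul_dampedPow_le {b c s z : ℝ} (hz : 0 < z) :
    c * dampedPow b c (s + b) z ≤ z ^ s := by
  have h : c * z ^ b * Real.exp (-c * z ^ b) ≤ 1 := by
    have h1 := Real.add_one_le_exp (c * z ^ b)
    rw [neg_mul, Real.exp_neg, ← div_eq_mul_inv, div_le_one (Real.exp_pos _)]
    linarith
  have h2 := mul_le_mul_of_nonneg_left h (Real.rpow_nonneg hz.le s)
  rw [dampedPow, Real.rpow_add hz]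
  linarith

lemma sq_mul_dampedPow_le {b c s z : ℝ} (hc : 0 ≤ c) (hz : 0 < z) :
    c ^ 2 * dampedPow b c (s + 2 * b) z ≤ 2 * z ^ s := by
  have hw : 0 ≤ c * z ^ b := mul_nonneg hc (Real.rpow_nonneg hz.le _)
  have h : (c * z ^ b) ^ 2 * Real.exp (-c * z ^ b) ≤ 2 := by
    have h1 := Real.quadratic_le_exp_of_nonneg hw
    rw [neg_mul, Real.exp_neg, ← div_eq_mul_inv, div_le_iff₀ (Real.exp_pos _)]
    linarith
  have h2 := mul_le_mul_of_nonneg_left h (Real.rpow_nonneg hz.le s)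
  rw [dampedPow, Real.rpow_add hz, two_mul, Real.rpow_add hz]
  linarith

lemma tendsto_dampedPow_zero (b s z : ℝ) :
    Tendsto (fun c => dampedPow b c s z) (𝓝[>] 0) (𝓝 (z ^ s)) := by
  have : Continuous fun c => dampedPow b c s z := by unfold dampedPow; fun_prop
  have h := this.tendsto 0
  simp only [dampedPow, neg_zero, zero_mul, Real.exp_zero, mul_one] at h
  exact h.mono_left nhdsWithin_le_nhds

lemma integrableOn_bdd_mul {f g : ℝ → ℝ} {s : Set ℝ} (hg : IntegrableOn g s) (hf : Continuous f)
    (hb : ∀ z, |f z| ≤ 1) : IntegrableOn (fun z => f z * g z) s :=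
  Integrable.bdd_mul (c := 1) hg hf.aestronglyMeasurable (ae_of_all _ fun z => by
    simpa using hb z)

lemma tendsto_mul_bdd_zero {f g : ℝ → ℝ} (hf : Tendsto f atTop (𝓝 0)) (hb : ∀ z, |g z| ≤ 1) :
    Tendsto (f * g) atTop (𝓝 0) := by
  have h : Tendsto (fun z => |f z|) atTop (𝓝 0) := by simpa using hf.abs
  refine squeeze_zero_norm (fun z => ?_) h
  rw [Pi.mul_apply, Real.norm_eq_abs, abs_mul]
  exact mul_le_of_le_one_right (abs_nonneg _) (hb z)

/-- The second derivative of `dampedPow b c s`. -/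
def dampedPowDeriv₂ (b c s z : ℝ) : ℝ :=
  s * (s - 1) * dampedPow b c (s - 2) z - b * (2 * s + b - 1) * (c * dampedPow b c (s - 2 + b) z) +
    b ^ 2 * (c ^ 2 * dampedPow b c (s - 2 + 2 * b) z)

lemma hasDerivAt_dampedPow_deriv (b c s : ℝ) {z : ℝ} (hz : 0 < z) :
    HasDerivAt (fun z => s * dampedPow b c (s - 1) z - c * b * dampedPow b c (s + b - 1) z)
      (dampedPowDeriv₂ b c s z) z := by
  refine (((hasDerivAt_dampedPow b c (s - 1) hz).const_mul s).sub
    ((hasDerivAt_dampedPow b c (s + b - 1) hz).const_mul (c * b))).congr_deriv ?_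
  rw [dampedPowDeriv₂, show s - 1 - 1 = s - 2 by ring, show s - 1 + b - 1 = s - 2 + b by ring,
    show s + b - 1 - 1 = s - 2 + b by ring, show s + b - 1 + b - 1 = s - 2 + 2 * b by ring]
  ring

lemma integrableOn_dampedPowDeriv₂ {b c : ℝ} (hb : 0 < b) (hc : 0 < c) (s : ℝ) :
    IntegrableOn (dampedPowDeriv₂ b c s) (Set.Ioi 1) :=
  (((integrableOn_dampedPow hb hc _).const_mul _).sub
    (((integrableOn_dampedPow hb hc _).const_mul _).const_mul _)).add
    (((integrableOn_dampedPow hb hc _).const_mul _).const_mul _)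

/-- Two integrations by parts, after which the integrand stays integrable for `c = 0` when
`s < 1`. -/
lemma integral_sin_mul_dampedPow {b c : ℝ} (hb : 0 < b) (hc : 0 < c) (s : ℝ) :
    ∫ z in Set.Ioi (1 : ℝ), Real.sin z * dampedPow b c s z =
      Real.cos 1 * dampedPow b c s 1 -
        Real.sin 1 * (s * dampedPow b c (s - 1) 1 - c * b * dampedPow b c (s + b - 1) 1) -
        ∫ z in Set.Ioi (1 : ℝ), Real.sin z * dampedPowDeriv₂ b c s z := by
  set G' : ℝ → ℝ := fun z => s * dampedPow b c (s - 1) z - c * b * dampedPow b c (s + b - 1) z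
    with hG'
  have hpos : ∀ z ∈ Set.Ioi (1 : ℝ), 0 < z := fun z hz => zero_lt_one.trans hz
  have hintG' : IntegrableOn G' (Set.Ioi 1) :=
    ((integrableOn_dampedPow hb hc _).const_mul _).sub
      ((integrableOn_dampedPow hb hc _).const_mul _)
  have hlimG' : Tendsto G' atTop (𝓝 0) := by
    simpa using ((tendsto_dampedPow_atTop hb hc (s - 1)).const_mul s).sub
      ((tendsto_dampedPow_atTop hb hc (s + b - 1)).const_mul (c * b))
  have hcont : ∀ {f : ℝ → ℝ} {f' : ℝ}, HasDerivAt f f' 1 → ∀ {g : ℝ → ℝ}, Continuous g →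
      Tendsto (f * g) (𝓝[>] 1) (𝓝 (f 1 * g 1)) := fun hf _ hg =>
    (hf.continuousAt.tendsto.mul (hg.tendsto 1)).mono_left nhdsWithin_le_nhds
  have h1 := integral_Ioi_mul_deriv_eq_deriv_mul (a := 1) (u := dampedPow b c s)
    (v := fun z => -Real.cos z) (u' := G') (v' := Real.sin)
    (a' := dampedPow b c s 1 * -Real.cos 1) (b' := 0)
    (fun z hz => hasDerivAt_dampedPow b c s (hpos z hz))
    (fun z hz => (Real.hasDerivAt_cos z).neg.congr_deriv (neg_neg _))
    ((integrableOn_bdd_mul (integrableOn_dampedPow hb hc s) Real.continuous_sin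
      Real.abs_sin_le_one).congr (ae_of_all _ fun z => mul_comm _ _))
    ((integrableOn_bdd_mul hintG' Real.continuous_cos.neg
      (fun z => by simpa using Real.abs_cos_le_one z)).congr (ae_of_all _ fun z => mul_comm _ _))
    (hcont (hasDerivAt_dampedPow b c s zero_lt_one) Real.continuous_cos.neg)
    (tendsto_mul_bdd_zero (tendsto_dampedPow_atTop hb hc s)
      (fun z => by simpa using Real.abs_cos_le_one z))
  have h2 := integral_Ioi_mul_deriv_eq_deriv_mul (a := 1) (u := G')
    (v := Real.sin) (u' := dampedPowDeriv₂ b c s) (v' := Real.cos)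
    (a' := G' 1 * Real.sin 1) (b' := 0)
    (fun z hz => hasDerivAt_dampedPow_deriv b c s (hpos z hz))
    (fun z hz => Real.hasDerivAt_sin z)
    ((integrableOn_bdd_mul hintG' Real.continuous_cos
      Real.abs_cos_le_one).congr (ae_of_all _ fun z => mul_comm _ _))
    ((integrableOn_bdd_mul (integrableOn_dampedPowDeriv₂ hb hc s) Real.continuous_sin
      Real.abs_sin_le_one).congr (ae_of_all _ fun z => mul_comm _ _))
    (hcont (hasDerivAt_dampedPow_deriv b c s zero_lt_one) Real.continuous_sin)
    (tendsto_mul_bdd_zero hlimG' Real.abs_sin_le_one)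
  simp only [mul_neg, integral_neg] at h1
  simp only [mul_comm (Real.sin _)]
  rw [h1, h2]
  ring

/-- The Abel-type regularized value of `∫₀^∞ z^{α-1} sin z dz`, `0 < α < 2`, in the form obtained
by integrating by parts twice on `(1, ∞)`. -/
def sineMoment (α : ℝ) : ℝ :=
  (∫ z in Set.Ioc (0 : ℝ) 1, Real.sin z * z ^ (α - 1)) +
    (Real.cos 1 - Real.sin 1 * (α - 1) -
      ∫ z in Set.Ioi (1 : ℝ), Real.sin z * ((α - 1) * (α - 1 - 1) * z ^ (α - 1 - 2)))

/-- The damped oscillatory integrals converge as the damping disappears. The limit does not depend on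
the exponent `b` in the damping factor. -/
lemma tendsto_integral_sin_mul_dampedPow {α b : ℝ} (hα0 : 0 < α) (hα2 : α < 2) (hb : 0 < b) :
    Tendsto (fun c => ∫ z in Set.Ioi (0 : ℝ), Real.sin z * dampedPow b c (α - 1) z) (𝓝[>] 0)
      (𝓝 (sineMoment α)) := by
  have hpos : ∀ᶠ c in 𝓝[>] (0 : ℝ), 0 < c := eventually_mem_nhdsWithin
  have hsplit : ∀ᶠ c in 𝓝[>] (0 : ℝ),
      (∫ z in Set.Ioc (0 : ℝ) 1, Real.sin z * dampedPow b c (α - 1) z) +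
      (Real.cos 1 * dampedPow b c (α - 1) 1 -
        Real.sin 1 * ((α - 1) * dampedPow b c (α - 1 - 1) 1 -
          c * b * dampedPow b c (α - 1 + b - 1) 1) -
        ∫ z in Set.Ioi (1 : ℝ), Real.sin z * dampedPowDeriv₂ b c (α - 1) z) =
      ∫ z in Set.Ioi (0 : ℝ), Real.sin z * dampedPow b c (α - 1) z := by
    filter_upwards [hpos] with c hc
    have hint := integrableOn_bdd_mul (integrableOn_dampedPow_Ioi_zero hb hc
      (s := α - 1) (by linarith)) Real.continuous_sin Real.abs_sin_le_one
    rw [← integral_sin_mul_dampedPow hb hc, ← setIntegral_union _ measurableSet_Ioi,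
      Set.Ioc_union_Ioi_eq_Ioi zero_le_one]
    · exact hint.mono_set Set.Ioc_subset_Ioi_self
    · exact hint.mono_set (Set.Ioi_subset_Ioi zero_le_one)
    · exact Set.disjoint_left.2 fun z hz hz' => not_lt.2 hz.2 hz'
  refine Tendsto.congr' hsplit ?_
  have hid : Tendsto (fun c : ℝ => c) (𝓝[>] 0) (𝓝 0) := tendsto_id.mono_left nhdsWithin_le_nhds
  refine Tendsto.add ?_ ((Tendsto.sub ?_ ?_).sub ?_)
  · refine tendsto_integral_filter_of_dominated_convergence (fun z => z ^ (α - 1))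
      (Eventually.of_forall fun c => ?_) ?_ ?_ (ae_of_all _ fun z => ?_)
    · have := measurable_dampedPow b c (α - 1)
      exact Measurable.aestronglyMeasurable (by fun_prop)
    · filter_upwards [hpos] with c hc
      filter_upwards [ae_restrict_mem measurableSet_Ioc] with z hz
      rw [Real.norm_eq_abs, abs_mul, abs_of_nonneg (dampedPow_nonneg _ _ _ hz.1.le)]
      refine (mul_le_of_le_one_left (dampedPow_nonneg _ _ _ hz.1.le) (Real.abs_sin_le_one z)).trans
        (dampedPow_le hc.le hz.1.le)
    · have := intervalIntegral.intervalIntegrable_rpow' (a := 0) (b := 1) (r := α - 1)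
        (by linarith)
      rwa [intervalIntegrable_iff_integrableOn_Ioc_of_le zero_le_one] at this
    · exact (tendsto_dampedPow_zero b (α - 1) z).const_mul _
  · simpa using (tendsto_dampedPow_zero b (α - 1) 1).const_mul (Real.cos 1)
  · have h1 := (tendsto_dampedPow_zero b (α - 1 - 1) 1).const_mul (α - 1)
    have h2 := (hid.mul_const b).mul (tendsto_dampedPow_zero b (α - 1 + b - 1) 1)
    simpa using (h1.sub h2).const_mul (Real.sin 1)
  · set K : ℝ := |(α - 1) * (α - 1 - 1)| + |b * (2 * (α - 1) + b - 1)| + b ^ 2 * 2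
    refine tendsto_integral_filter_of_dominated_convergence (fun z => K * z ^ (α - 1 - 2))
      (Eventually.of_forall fun c => ?_) ?_ ?_ ?_
    · have := measurable_dampedPow b c
      unfold dampedPowDeriv₂
      exact Measurable.aestronglyMeasurable (by fun_prop)
    · filter_upwards [hpos] with c hc
      filter_upwards [ae_restrict_mem measurableSet_Ioi] with z hz
      have hz0 : (0 : ℝ) < z := zero_lt_one.trans hz
      rw [Real.norm_eq_abs, abs_mul]
      refine (mul_le_of_le_one_left (abs_nonneg _) (Real.abs_sin_le_one z)).trans ?_
      have e1 := dampedPow_le (b := b) (s := α - 1 - 2) hc.le hz0.le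
      have e2 := mul_dampedPow_le (b := b) (c := c) (s := α - 1 - 2) hz0
      have e3 := sq_mul_dampedPow_le (b := b) (s := α - 1 - 2) hc.le hz0
      have p1 := dampedPow_nonneg b c (α - 1 - 2) hz0.le
      have p2 := mul_nonneg hc.le (dampedPow_nonneg b c (α - 1 - 2 + b) hz0.le)
      have p3 := mul_nonneg (sq_nonneg c) (dampedPow_nonneg b c (α - 1 - 2 + 2 * b) hz0.le)
      unfold dampedPowDeriv₂
      refine (abs_add_le _ _).trans ((add_le_add_left (abs_sub _ _) _).trans ?_)
      rw [abs_mul, abs_mul (b * _), abs_mul (b ^ 2), abs_of_nonneg p1, abs_of_nonneg p2,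
        abs_of_nonneg p3, abs_of_nonneg (sq_nonneg b)]
      calc _ ≤ |(α - 1) * (α - 1 - 1)| * z ^ (α - 1 - 2) +
            |b * (2 * (α - 1) + b - 1)| * z ^ (α - 1 - 2) +
            b ^ 2 * (2 * z ^ (α - 1 - 2)) := by gcongr
        _ = _ := by ring
    · exact (integrableOn_Ioi_rpow_of_lt (by linarith) zero_lt_one).const_mul K
    · filter_upwards [ae_restrict_mem measurableSet_Ioi] with z hz
      have h1 := (tendsto_dampedPow_zero b (α - 1 - 2) z).const_mul ((α - 1) * (α - 1 - 1))
      have h2 := (hid.mul (tendsto_dampedPow_zero b (α - 1 - 2 + b) z)).const_mul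
        (b * (2 * (α - 1) + b - 1))
      have h3 := ((hid.pow 2).mul (tendsto_dampedPow_zero b (α - 1 - 2 + 2 * b) z)).const_mul
        (b ^ 2)
      have h4 := ((h1.sub h2).add h3).const_mul (Real.sin z)
      simpa [dampedPowDeriv₂] using h4

/-! ### Positivity of the oscillatory integral -/

lemma integral_id_mul_sin_mul_exp {r : ℝ} (hr : 0 < r) :
    ∫ z in Set.Ioi (0 : ℝ), z * Real.sin z * Real.exp (-(r * z)) = 2 * r / (1 + r ^ 2) ^ 2 := by
  let A : ℝ → ℝ := fun z => Real.exp (-(r * z)) * (-(z * (r * Real.sin z + Real.cos z) / (1 + r ^ 2))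
    - ((r ^ 2 - 1) * Real.sin z + 2 * r * Real.cos z) / (1 + r ^ 2) ^ 2)
  have hr2 : (1 + r ^ 2) ≠ 0 := by positivity
  have hderiv : ∀ z : ℝ, HasDerivAt A (z * Real.sin z * Real.exp (-(r * z))) z := by
    intro z
    have h1 : HasDerivAt (fun z => Real.exp (-(r * z))) (Real.exp (-(r * z)) * -(r * 1)) z :=
      (((hasDerivAt_id z).const_mul r).neg).exp
    have hs := Real.hasDerivAt_sin z
    have hcs := Real.hasDerivAt_cos z
    have h2 := (((hasDerivAt_id z).mul ((hs.const_mul r).add hcs)).div_const (1 + r ^ 2)).neg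
    have h3 := ((hs.const_mul (r ^ 2 - 1)).add (hcs.const_mul (2 * r))).div_const
      ((1 + r ^ 2) ^ 2)
    refine (h1.mul (h2.sub h3)).congr_deriv ?_
    simp only [id, Pi.mul_apply, Pi.add_apply, Pi.neg_apply, Pi.sub_apply]
    field_simp
    ring
  have hz1 : Tendsto (fun z : ℝ => z * Real.exp (-(r * z))) atTop (𝓝 0) := by
    have := tendsto_rpow_mul_exp_neg_mul_atTop_nhds_zero 1 r hr
    simpa using this
  have hz0 : Tendsto (fun z : ℝ => Real.exp (-(r * z))) atTop (𝓝 0) := by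
    have := tendsto_rpow_mul_exp_neg_mul_atTop_nhds_zero 0 r hr
    simpa using this
  have hint : IntegrableOn (fun z => z * Real.sin z * Real.exp (-(r * z))) (Set.Ioi 0) := by
    have h := integrableOn_bdd_mul (integrableOn_dampedPow_Ioi_zero (b := 1) zero_lt_one hr
      (s := 1) (by norm_num)) Real.continuous_sin Real.abs_sin_le_one
    refine h.congr (ae_of_all _ fun z => ?_)
    simp only [dampedPow, Real.rpow_one, neg_mul]
    ring
  have hlim : Tendsto A atTop (𝓝 0) := by
    have ha := tendsto_mul_bdd_zero hz1 Real.abs_sin_le_one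
    have hb := tendsto_mul_bdd_zero hz1 Real.abs_cos_le_one
    have hc := tendsto_mul_bdd_zero hz0 Real.abs_sin_le_one
    have hd := tendsto_mul_bdd_zero hz0 Real.abs_cos_le_one
    have := (((ha.const_mul (-(r / (1 + r ^ 2)))).add (hb.const_mul (-(1 / (1 + r ^ 2))))).add
      (hc.const_mul (-((r ^ 2 - 1) / (1 + r ^ 2) ^ 2)))).add
      (hd.const_mul (-(2 * r / (1 + r ^ 2) ^ 2)))
    simp only [mul_zero, add_zero] at this
    refine this.congr fun z => ?_
    simp only [Pi.mul_apply, A]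
    field_simp
    ring
  rw [integral_Ioi_of_hasDerivAt_of_tendsto (hderiv 0).continuousAt.continuousWithinAt
    (fun z _ => hderiv z) hint hlim]
  simp [A]

/-- Positivity of the constant: as the limit does not depend on the damping, one may damp with
`e^{-c z}`. Writing `z ^ (α - 2)` as a Laplace transform of `s ^ (1 - α)` and exchanging the
integrals turns the oscillatory integral into the integral of a positive function of `s`, which is
bounded below uniformly in `c` by its part over `(1, 2]`. -/
lemma sineMoment_pos {α : ℝ} (hα0 : 0 < α) (hα2 : α < 2) : 0 < sineMoment α := by
  have hΓ : 0 < Real.Gamma (2 - α) := Real.Gamma_pos_of_pos (by linarith)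
  suffices h : ∀ᶠ c in 𝓝[>] (0 : ℝ), 1 / (100 * Real.Gamma (2 - α)) ≤
      ∫ z in Set.Ioi (0 : ℝ), Real.sin z * dampedPow 1 c (α - 1) z from
    lt_of_lt_of_le (by positivity) (ge_of_tendsto
      (tendsto_integral_sin_mul_dampedPow hα0 hα2 one_pos) h)
  have hev : ∀ᶠ c in 𝓝[>] (0 : ℝ), c ∈ Set.Ioo (0 : ℝ) 1 := Ioo_mem_nhdsGT zero_lt_one
  filter_upwards [hev] with c hc
  have hc0 : 0 < c := hc.1
  let f : ℝ → ℝ → ℝ := fun z s => Real.sin z * z * Real.exp (-(c * z)) *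
    (s ^ (1 - α) * Real.exp (-(z * s)))
  have hgam : ∀ z ∈ Set.Ioi (0 : ℝ), ∫ s in Set.Ioi (0 : ℝ), s ^ (1 - α) * Real.exp (-(z * s)) =
      z ^ (α - 2) * Real.Gamma (2 - α) := by
    intro z hz
    have hz0 : (0 : ℝ) < z := hz
    have := Real.integral_rpow_mul_exp_neg_mul_Ioi (a := 2 - α) (r := z) (by linarith) hz
    rw [show 2 - α - 1 = 1 - α by ring] at this
    rw [this, one_div, Real.inv_rpow hz0.le, ← Real.rpow_neg hz0.le]
    congr 2
    ring
  have hmeas : Measurable (Function.uncurry f) := by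
    simp only [f, Function.uncurry_def]
    fun_prop
  have hzpow : ∀ z ∈ Set.Ioi (0 : ℝ), z * z ^ (α - 2) = z ^ (α - 1) := by
    intro z hz
    have hz0 : (0 : ℝ) < z := hz
    rw [show α - 1 = 1 + (α - 2) by ring, Real.rpow_add hz0, Real.rpow_one]
  have hint : Integrable (Function.uncurry f)
      ((volume.restrict (Set.Ioi 0)).prod (volume.restrict (Set.Ioi 0))) := by
    rw [integrable_prod_iff hmeas.aestronglyMeasurable]
    constructor
    · filter_upwards [ae_restrict_mem measurableSet_Ioi] with z hz
      have := integrableOn_dampedPow_Ioi_zero (b := 1) (c := z) (s := 1 - α) one_pos hz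
        (by linarith)
      refine (this.const_mul (Real.sin z * z * Real.exp (-(c * z)))).congr (ae_of_all _ fun s => ?_)
      simp [f, dampedPow]
    · have := ((integrableOn_bdd_mul (f := fun z => |Real.sin z|) (integrableOn_dampedPow_Ioi_zero
        (b := 1) (c := c) (s := α - 1) one_pos hc0 (by linarith)) Real.continuous_sin.abs
        (fun z => by simpa using Real.abs_sin_le_one z))).mul_const (Real.Gamma (2 - α))
      refine this.congr ?_
      filter_upwards [ae_restrict_mem measurableSet_Ioi] with z hz
      have hz0 : (0 : ℝ) < z := hz
      have h1 : ∫ s in Set.Ioi (0 : ℝ), ‖Function.uncurry f (z, s)‖ =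
          ∫ s in Set.Ioi (0 : ℝ), |Real.sin z| * z * Real.exp (-(c * z)) *
            (s ^ (1 - α) * Real.exp (-(z * s))) := by
        refine setIntegral_congr_fun measurableSet_Ioi fun s hs => ?_
        have hs0 : (0 : ℝ) < s := hs
        simp only [Function.uncurry_apply_pair, f]
        rw [Real.norm_eq_abs, abs_mul, abs_mul, abs_mul, abs_of_pos hz0,
          abs_of_pos (Real.exp_pos _), abs_of_pos (mul_pos (Real.rpow_pos_of_pos hs0 _)
            (Real.exp_pos _))]
      rw [h1, integral_const_mul, hgam z hz, dampedPow, ← hzpow z hz, Real.rpow_one, neg_mul]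
      ring
  have hswap := integral_integral_swap hint
  have hL : ∫ z in Set.Ioi (0 : ℝ), ∫ s in Set.Ioi (0 : ℝ), f z s =
      (∫ z in Set.Ioi (0 : ℝ), Real.sin z * dampedPow 1 c (α - 1) z) * Real.Gamma (2 - α) := by
    rw [← integral_mul_const]
    refine setIntegral_congr_fun measurableSet_Ioi fun z hz => ?_
    simp only [f]
    rw [integral_const_mul, hgam z hz, dampedPow, ← hzpow z hz, Real.rpow_one, neg_mul]
    ring
  have hinner : ∀ s ∈ Set.Ioi (0 : ℝ), ∫ z in Set.Ioi (0 : ℝ), f z s =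
      s ^ (1 - α) * (2 * (c + s) / (1 + (c + s) ^ 2) ^ 2) := by
    intro s hs
    have hs0 : (0 : ℝ) < s := hs
    rw [← integral_id_mul_sin_mul_exp (add_pos hc0 hs0), ← integral_const_mul]
    refine setIntegral_congr_fun measurableSet_Ioi fun z hz => ?_
    simp only [f]
    rw [show -((c + s) * z) = -(c * z) + -(z * s) by ring, Real.exp_add]
    ring
  have hR : ∫ s in Set.Ioi (0 : ℝ), ∫ z in Set.Ioi (0 : ℝ), f z s =
      ∫ s in Set.Ioi (0 : ℝ), s ^ (1 - α) * (2 * (c + s) / (1 + (c + s) ^ 2) ^ 2) :=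
    setIntegral_congr_fun measurableSet_Ioi hinner
  have hintR : IntegrableOn (fun s => s ^ (1 - α) * (2 * (c + s) / (1 + (c + s) ^ 2) ^ 2))
      (Set.Ioi 0) := by
    refine (hint.integral_prod_right).congr ?_
    filter_upwards [ae_restrict_mem measurableSet_Ioi] with s hs using hinner s hs
  have hlow : (1 / 100 : ℝ) ≤
      ∫ s in Set.Ioi (0 : ℝ), s ^ (1 - α) * (2 * (c + s) / (1 + (c + s) ^ 2) ^ 2) := by
    have h1 : ∫ s in Set.Ioc (1 : ℝ) 2, (1 / 100 : ℝ) = 1 / 100 := by simp; norm_num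
    rw [← h1]
    refine (setIntegral_mono_on (by simp) (hintR.mono_set fun s hs =>
      zero_lt_one.trans hs.1) measurableSet_Ioc fun s hs => ?_).trans
      (setIntegral_mono_set hintR ?_ (LE.le.eventuallyLE fun s hs =>
        zero_lt_one.trans hs.1))
    · have hs1 : 1 < s := hs.1
      have hs2 : s ≤ 2 := hs.2
      have e1 : (1 / 2 : ℝ) ≤ s ^ (1 - α) := by
        have : s ^ (-1 : ℝ) ≤ s ^ (1 - α) :=
          Real.rpow_le_rpow_of_exponent_le hs1.le (by linarith)
        refine le_trans ?_ this
        rw [Real.rpow_neg_one, one_div]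
        exact inv_anti₀ (by linarith) hs2
      have e2 : (1 / 50 : ℝ) ≤ 2 * (c + s) / (1 + (c + s) ^ 2) ^ 2 := by
        have hr1 : 1 ≤ c + s := by linarith
        have hr3 : c + s ≤ 3 := by linarith [hc.2]
        rw [div_le_div_iff₀ (by norm_num) (by positivity)]
        have : (1 + (c + s) ^ 2) ≤ 10 := by nlinarith
        have h4 : (1 + (c + s) ^ 2) ^ 2 ≤ 10 ^ 2 := by gcongr
        linarith
      calc (1 / 100 : ℝ) = 1 / 2 * (1 / 50) := by norm_num
        _ ≤ _ := by gcongr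
    · filter_upwards [ae_restrict_mem measurableSet_Ioi] with s hs
      have hs0 : (0 : ℝ) < s := hs
      simp only [Pi.zero_apply]
      positivity
  rw [hL, hR] at hswap
  rw [← hswap] at hlow
  rw [div_le_iff₀ (by positivity)]
  linarith

/-! ### The tail of the stable density -/

/-- An integration by parts and the substitution `z = x y` in the Fourier integral. The tail
`x → ∞` becomes the limit of vanishing damping `t x ^ (-α)`. -/
lemma stableDensity_eq_sin_integral {α t : ℝ} (hα : 0 < α) (ht : 0 < t) {x : ℝ} (hx : 0 < x) :
    x ^ (1 + α) * stableDensity α t x = α * t / Real.pi *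
      ∫ z in Set.Ioi (0 : ℝ), Real.sin z * dampedPow α (t * x ^ (-α)) (α - 1) z := by
  have h1 : ∫ y : ℝ, Real.cos (x * y) * Real.exp (-(t * |y| ^ α)) =
      2 * ∫ y in Set.Ioi (0 : ℝ), Real.cos (x * y) * Real.exp (-(t * y ^ α)) := by
    rw [← integral_comp_abs (f := fun y => Real.cos (x * y) * Real.exp (-(t * y ^ α)))]
    congr 1 with y
    congr 1
    rcases abs_choice y with h | h <;> simp [h]
  have h2 := integral_Ioi_mul_deriv_eq_deriv_mul (a := 0) (u := dampedPow α t 0)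
    (v := fun y => Real.sin (x * y) / x)
    (u' := fun y => 0 * dampedPow α t (0 - 1) y - t * α * dampedPow α t (0 + α - 1) y)
    (v' := fun y => Real.cos (x * y)) (a' := 0) (b' := 0)
    (fun y hy => hasDerivAt_dampedPow α t 0 hy)
    (fun y hy => by
      have := (((hasDerivAt_id y).const_mul x).sin).div_const x
      refine this.congr_deriv ?_
      simp only [id]
      field_simp)
    ((integrableOn_bdd_mul (integrableOn_dampedPow_Ioi_zero hα ht (s := 0) (by norm_num))
      (f := fun y => Real.cos (x * y)) (by fun_prop) (fun y => Real.abs_cos_le_one _)).congr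
        (ae_of_all _ fun z => mul_comm _ _))
    (((integrableOn_bdd_mul (integrableOn_dampedPow_Ioi_zero hα ht (s := α - 1) (by linarith))
      (f := fun y => Real.sin (x * y)) (by fun_prop) (fun y => Real.abs_sin_le_one _)).const_mul
        (-(t * α) / x)).congr (ae_of_all _ fun z => by
          simp only [Pi.mul_apply, zero_add]
          ring))
    (by
      have hcont : Continuous fun y : ℝ => Real.exp (-t * y ^ α) * (Real.sin (x * y) / x) := by
        have := Real.continuous_rpow_const hα.le
        fun_prop
      have h0 := hcont.tendsto 0
      simp only [mul_zero, Real.sin_zero, zero_div] at h0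
      refine (h0.mono_left nhdsWithin_le_nhds).congr fun y => ?_
      simp [dampedPow])
    (by
      have := (tendsto_mul_bdd_zero (tendsto_dampedPow_atTop hα ht 0)
        (g := fun y => Real.sin (x * y)) (fun z => Real.abs_sin_le_one _)).mul_const x⁻¹
      simp only [zero_mul] at this
      refine this.congr fun y => ?_
      simp only [Pi.mul_apply]
      ring)
  have h3 : ∫ y in Set.Ioi (0 : ℝ), Real.cos (x * y) * Real.exp (-(t * y ^ α)) =
      t * α / x * ∫ y in Set.Ioi (0 : ℝ), Real.sin (x * y) * dampedPow α t (α - 1) y := by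
    have e1 : ∫ y in Set.Ioi (0 : ℝ), Real.cos (x * y) * Real.exp (-(t * y ^ α)) =
        ∫ y in Set.Ioi (0 : ℝ), dampedPow α t 0 y * Real.cos (x * y) := by
      congr 1 with y
      simp [dampedPow, mul_comm]
    rw [e1, h2, ← integral_const_mul, sub_zero, zero_sub, ← integral_neg]
    congr 1 with y
    simp only [zero_add]
    ring
  have h4 := integral_comp_mul_left_Ioi
    (fun z => Real.sin z * dampedPow α (t * x ^ (-α)) (α - 1) z) 0 hx
  rw [mul_zero, smul_eq_mul] at h4
  have h5 : ∫ y in Set.Ioi (0 : ℝ), Real.sin (x * y) *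
      dampedPow α (t * x ^ (-α)) (α - 1) (x * y) =
      x ^ (α - 1) * ∫ y in Set.Ioi (0 : ℝ), Real.sin (x * y) * dampedPow α t (α - 1) y := by
    rw [← integral_const_mul]
    refine setIntegral_congr_fun measurableSet_Ioi fun y hy => ?_
    have hy0 : (0 : ℝ) < y := hy
    simp only [dampedPow]
    rw [Real.mul_rpow hx.le hy0.le, Real.mul_rpow hx.le hy0.le]
    have : -(t * x ^ (-α)) * (x ^ α * y ^ α) = -t * y ^ α := by
      rw [Real.rpow_neg hx.le]
      have := (Real.rpow_pos_of_pos hx α).ne'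
      field_simp
    rw [this]
    ring
  rw [h5] at h4
  set I := ∫ y in Set.Ioi (0 : ℝ), Real.sin (x * y) * dampedPow α t (α - 1) y
  set J := ∫ z in Set.Ioi (0 : ℝ), Real.sin z * dampedPow α (t * x ^ (-α)) (α - 1) z
  have h6 : J = x ^ α * I := by
    have : x ^ (α - 1) = x ^ α / x := by rw [Real.rpow_sub hx, Real.rpow_one]
    rw [this] at h4
    field_simp at h4
    linarith
  rw [stableDensity, h1, h3, h6, Real.rpow_add hx, Real.rpow_one]
  have := Real.pi_pos
  field_simp

lemma tendsto_stableDensity_of_lt_two {α t : ℝ} (hα : 0 < α) (hα2 : α < 2) (ht : 0 < t) :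
    Tendsto (fun x => x ^ (1 + α) * stableDensity α t x) atTop
      (𝓝 (α * t / Real.pi * sineMoment α)) := by
  have hc : Tendsto (fun x : ℝ => t * x ^ (-α)) atTop (𝓝[>] 0) := by
    refine tendsto_nhdsWithin_iff.2 ⟨?_, ?_⟩
    · simpa using (tendsto_rpow_neg_atTop hα).const_mul t
    · filter_upwards [eventually_gt_atTop 0] with x hx
      exact mul_pos ht (Real.rpow_pos_of_pos hx _)
  refine (((tendsto_integral_sin_mul_dampedPow hα hα2 hα).comp hc).const_mul
    (α * t / Real.pi)).congr' ?_
  filter_upwards [eventually_gt_atTop 0] with x hx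
  rw [stableDensity_eq_sin_integral hα ht hx]
  rfl

lemma stableDensity_two {t : ℝ} (ht : 0 < t) (x : ℝ) :
    stableDensity 2 t x = (2 * Real.pi)⁻¹ * ((Real.pi / t) ^ (1 / 2 : ℝ) *
      Real.exp (-x ^ 2 / (4 * t))) := by
  rw [← gaussCosTransform_one ht, stableDensity, gaussCosTransform]
  simp

lemma tendsto_stableDensity_two {t : ℝ} (ht : 0 < t) :
    Tendsto (fun x => x ^ (1 + 2 : ℝ) * stableDensity 2 t x) atTop (𝓝 0) := by
  have h := (tendsto_dampedPow_atTop (b := 2) (c := 1 / (4 * t)) two_pos (by positivity)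
    (1 + 2)).const_mul ((2 * Real.pi)⁻¹ * (Real.pi / t) ^ (1 / 2 : ℝ))
  rw [mul_zero] at h
  refine h.congr fun x => ?_
  rw [stableDensity_two ht, dampedPow, Real.rpow_two,
    show -(1 / (4 * t)) * x ^ 2 = -x ^ 2 / (4 * t) by ring]
  ring

/-- The limit of `x ^ (1 + α) p_t(x)` as `x → ∞`. It vanishes for `α = 2`, where the density is
Gaussian. -/
def tailConst (α t : ℝ) : ℝ := if α = 2 then 0 else α * t / Real.pi * sineMoment α

lemma tailConst_pos {α t : ℝ} (hα : 0 < α) (hα2 : α < 2) (ht : 0 < t) : 0 < tailConst α t := by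
  have := sineMoment_pos hα hα2
  rw [tailConst, if_neg hα2.ne]
  positivity

lemma tendsto_stableDensity {α t : ℝ} (hα : 0 < α) (hα2 : α ≤ 2) (ht : 0 < t) :
    Tendsto (fun x => x ^ (1 + α) * stableDensity α t x) atTop (𝓝 (tailConst α t)) := by
  rcases hα2.eq_or_lt with rfl | h
  · simpa [tailConst] using tendsto_stableDensity_two ht
  · simpa [tailConst, h.ne] using tendsto_stableDensity_of_lt_two hα h ht

/-! ### Integrability, Fourier transform and semigroup property of the stable density -/

lemma integrable_stableDensity {α t : ℝ} (hα : 0 < α) (hα2 : α ≤ 2) (ht : 0 < t) :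
    Integrable (stableDensity α t) := by
  refine (continuous_stableDensity hα ht).locallyIntegrable
    |>.integrable_of_isBigO_atTop_of_norm_isNegInvariant (g := fun x : ℝ => x ^ (-1 - α))
    (ae_of_all _ fun x => ?_) ?_ (integrableAtFilter_rpow_atTop_iff.2 (by linarith))
  · simp [stableDensity_neg]
  · have h := (tendsto_stableDensity hα hα2 ht).isBigO_one ℝ
    have h2 := (Asymptotics.isBigO_refl (fun x : ℝ => x ^ (-1 - α)) atTop).mul h
    refine h2.congr' ?_ (Eventually.of_forall fun x => mul_one _)
    filter_upwards [eventually_gt_atTop 0] with x hx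
    rw [← mul_assoc, ← Real.rpow_add hx, show -1 - α + (1 + α) = 0 by ring, Real.rpow_zero,
      one_mul]

lemma integral_sin_mul_even {f : ℝ → ℝ} (hf : ∀ x, f (-x) = f x) (a : ℝ) :
    ∫ x, Real.sin (a * x) * f x = 0 := by
  have h := integral_neg_eq_self (fun x => Real.sin (a * x) * f x) (volume : Measure ℝ)
  have h2 : ∀ x, Real.sin (a * -x) * f (-x) = -(Real.sin (a * x) * f x) := by
    intro x
    rw [hf, mul_neg, Real.sin_neg, neg_mul]
  simp only [h2, integral_neg] at h
  linarith

lemma integrable_sin_mul {f : ℝ → ℝ} (hf : Integrable f) (x : ℝ) :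
    Integrable fun y => Real.sin (x * y) * f y := by
  refine hf.bdd_mul (c := 1) (by fun_prop) (ae_of_all _ fun y => ?_)
  simpa using Real.abs_sin_le_one (x * y)

lemma integral_exp_mul_even {f : ℝ → ℝ} (hint : Integrable f) (hf : ∀ x, f (-x) = f x) (a : ℝ) :
    ∫ x : ℝ, Complex.exp (((a * x : ℝ) : ℂ) * Complex.I) * (f x : ℂ) =
      ((∫ x, Real.cos (a * x) * f x : ℝ) : ℂ) := by
  have h1 : ∀ x : ℝ, Complex.exp (((a * x : ℝ) : ℂ) * Complex.I) * (f x : ℂ) =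
      ((Real.cos (a * x) * f x : ℝ) : ℂ) + ((Real.sin (a * x) * f x : ℝ) : ℂ) * Complex.I := by
    intro x
    rw [Complex.exp_mul_I]
    push_cast
    ring
  simp only [h1]
  rw [integral_add (integrable_cos_mul hint a).ofReal ((integrable_sin_mul hint a).ofReal.mul_const _),
    integral_mul_const, integral_complex_ofReal, integral_complex_ofReal, integral_sin_mul_even hf]
  simp

/-- The Fourier transform of the stable density, by Fourier inversion. -/
lemma integral_cos_mul_stableDensity {α t : ℝ} (hα : 0 < α) (hα2 : α ≤ 2) (ht : 0 < t) (y : ℝ) :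
    ∫ x, Real.cos (y * x) * stableDensity α t x = Real.exp (-(t * |y| ^ α)) := by
  set E : ℝ → ℝ := fun y => Real.exp (-(t * |y| ^ α)) with hE
  have hEint : Integrable E := integrable_exp_neg_mul_abs_rpow hα ht
  have hEeven : ∀ x, E (-x) = E x := fun x => by simp [hE]
  have hEcont : Continuous E := by
    have := Real.continuous_rpow_const hα.le
    fun_prop
  have hpint := integrable_stableDensity hα hα2 ht
  have hF : FourierTransform.fourier (fun y => (E y : ℂ)) =
      fun ξ : ℝ => ((2 * Real.pi * stableDensity α t (2 * Real.pi * ξ) : ℝ) : ℂ) := by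
    ext ξ
    rw [Real.fourier_eq']
    have h := integral_exp_mul_even hEint hEeven (-2 * Real.pi * ξ)
    simp only [smul_eq_mul]
    rw [stableDensity, ← mul_assoc, mul_inv_cancel₀ (by positivity), one_mul]
    have hcos : ∀ x, Real.cos (-2 * Real.pi * ξ * x) = Real.cos (2 * Real.pi * ξ * x) := by
      intro x
      rw [← Real.cos_neg]
      congr 1
      ring
    simp only [hcos] at h
    rw [← h]
    congr 1 with x
    congr 4
    simp
    ring
  have hFint : Integrable (FourierTransform.fourier (fun y => (E y : ℂ))) := by
    rw [hF]
    exact ((hpint.comp_mul_left' (by positivity)).const_mul _).ofReal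
  have hinv := congrFun (Continuous.fourierInv_fourier_eq (by fun_prop) hEint.ofReal hFint) y
  rw [hF, Real.fourierInv_eq'] at hinv
  have h := integral_exp_mul_even (f := fun ξ => 2 * Real.pi * stableDensity α t (2 * Real.pi * ξ))
    ((hpint.comp_mul_left' (by positivity)).const_mul _)
    (fun x => by simp only [mul_neg, stableDensity_neg]) (2 * Real.pi * y)
  have h2 : (∫ x, Real.cos (2 * Real.pi * y * x) *
      (2 * Real.pi * stableDensity α t (2 * Real.pi * x)) : ℝ) = E y := by
    rw [← Complex.ofReal_inj, ← h, ← hinv]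
    congr 1 with x
    simp only [smul_eq_mul]
    congr 4
    simp
    ring
  change _ = E y
  rw [← h2]
  have h3 := Measure.integral_comp_mul_left
    (fun x => Real.cos (y * x) * stableDensity α t x) (2 * Real.pi)
  rw [abs_of_pos (by positivity), smul_eq_mul] at h3
  have h4 : ∫ x, Real.cos (2 * Real.pi * y * x) *
      (2 * Real.pi * stableDensity α t (2 * Real.pi * x)) = 2 * Real.pi *
      ∫ x, Real.cos (y * (2 * Real.pi * x)) * stableDensity α t (2 * Real.pi * x) := by
    rw [← integral_const_mul]
    congr 1 with x
    rw [show 2 * Real.pi * y * x = y * (2 * Real.pi * x) by ring]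
    ring
  rw [h4, h3, ← mul_assoc, mul_inv_cancel₀ (by positivity), one_mul]

lemma integral_stableDensity {α t : ℝ} (hα : 0 < α) (hα2 : α ≤ 2) (ht : 0 < t) :
    ∫ x, stableDensity α t x = 1 := by
  have h := integral_cos_mul_stableDensity hα hα2 ht 0
  simpa [Real.zero_rpow hα.ne'] using h

/-- The Chapman–Kolmogorov equation `p_s * p_t = p_{s+t}`. -/
lemma integral_stableDensity_mul {α s t : ℝ} (hα : 0 < α) (hα2 : α ≤ 2) (hs : 0 < s) (ht : 0 < t)
    (u : ℝ) : ∫ w, stableDensity α s (u - w) * stableDensity α t w =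
      stableDensity α (s + t) u := by
  have hpint := integrable_stableDensity hα hα2 ht
  have hpcont := continuous_stableDensity hα ht
  have hEint := integrable_exp_neg_mul_abs_rpow hα hs
  let f : ℝ → ℝ → ℝ := fun w y =>
    Real.cos ((u - w) * y) * (stableDensity α t w * Real.exp (-(s * |y| ^ α)))
  have hint : Integrable (Function.uncurry f) ((volume : Measure ℝ).prod volume) := by
    refine (hpint.mul_prod hEint).bdd_mul (c := 1)
      (f := fun z : ℝ × ℝ => Real.cos ((u - z.1) * z.2)) (by fun_prop) (ae_of_all _ fun z => ?_)
    simpa using Real.abs_cos_le_one _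
  have hswap := integral_integral_swap hint
  have h1 : ∀ w, stableDensity α s (u - w) * stableDensity α t w =
      (2 * Real.pi)⁻¹ * ∫ y, f w y := by
    intro w
    rw [stableDensity, mul_assoc, ← integral_mul_const]
    congr 2 with y
    simp only [f]
    ring
  have h2 : ∀ y, ∫ w, f w y = Real.cos (u * y) * Real.exp (-((s + t) * |y| ^ α)) := by
    intro y
    have hsplit : ∀ w, f w y = Real.cos (u * y) * Real.exp (-(s * |y| ^ α)) *
        (Real.cos (y * w) * stableDensity α t w) + Real.sin (u * y) * Real.exp (-(s * |y| ^ α)) *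
        (Real.sin (y * w) * stableDensity α t w) := by
      intro w
      simp only [f]
      rw [sub_mul, Real.cos_sub, mul_comm w y]
      ring
    simp only [hsplit]
    rw [integral_add ((integrable_cos_mul hpint y).const_mul _)
      ((integrable_sin_mul hpint y).const_mul _), integral_const_mul, integral_const_mul,
      integral_sin_mul_even (stableDensity_neg α t), integral_cos_mul_stableDensity hα hα2 ht,
      mul_zero, add_zero, mul_assoc, ← Real.exp_add]
    congr 2
    ring
  simp only [h1]
  rw [integral_const_mul, hswap, stableDensity]
  simp only [h2]

lemma stableDensity_le {α t : ℝ} (hα : 0 < α) (hα2 : α ≤ 2) (ht : 0 < t) (x : ℝ) :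
    stableDensity α t x ≤ stableDensity α t 0 :=
  stableDensity_anti hα hα2 ht (by simp)

/-- The second term of the covariance functional at equal times, as a double integral against
the density at the doubled time. -/
lemma integral_stableSemigroup_mul {α t : ℝ} (hα : 0 < α) (hα2 : α ≤ 2) (ht : 0 < t)
    {f g : ℝ → ℝ} (hf : Integrable f) (hg : Integrable g) :
    ∫ x, stableSemigroup α t f x * stableSemigroup α t g x =
      ∫ z : ℝ × ℝ, stableDensity α (t + t) (z.1 - z.2) * (f z.1 * g z.2) := by
  have hp := integrable_stableDensity hα hα2 ht
  have hpc := continuous_stableDensity hα ht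
  have hpc2 := continuous_stableDensity hα (add_pos ht ht)
  have hconv : ∀ a b : ℝ, ∫ x, stableDensity α t (x - a) * stableDensity α t (x - b) =
      stableDensity α (t + t) (a - b) := by
    intro a b
    rw [← stableDensity_neg, neg_sub, ← integral_stableDensity_mul hα hα2 ht ht,
      ← integral_sub_right_eq_self
        (fun w => stableDensity α t (b - a - w) * stableDensity α t w) a]
    congr 1 with x
    rw [← stableDensity_neg α t (x - b), mul_comm]
    congr 2
    ring
  let F : ℝ → ℝ × ℝ → ℝ := fun x z =>
    (stableDensity α t (x - z.1) * stableDensity α t (x - z.2)) * (f z.1 * g z.2)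
  have hfg : Integrable (fun z : ℝ × ℝ => f z.1 * g z.2) := hf.mul_prod hg
  have hFm : AEStronglyMeasurable (Function.uncurry F)
      ((volume : Measure ℝ).prod (volume : Measure (ℝ × ℝ))) := by
    refine AEStronglyMeasurable.mul (Continuous.aestronglyMeasurable (by fun_prop)) ?_
    exact hfg.aestronglyMeasurable.comp_quasiMeasurePreserving Measure.quasiMeasurePreserving_snd
  have hpp : ∀ a b : ℝ, Integrable fun x => stableDensity α t (x - a) * stableDensity α t (x - b) := by
    intro a b
    refine (hp.comp_sub_right b).bdd_mul (c := stableDensity α t 0) (by fun_prop)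
      (ae_of_all _ fun x => ?_)
    rw [Real.norm_eq_abs, abs_of_nonneg (stableDensity_nonneg hα hα2 ht _)]
    exact stableDensity_le hα hα2 ht _
  have hint : Integrable (Function.uncurry F)
      ((volume : Measure ℝ).prod (volume : Measure (ℝ × ℝ))) := by
    rw [integrable_prod_iff' hFm]
    refine ⟨ae_of_all _ fun z => (hpp z.1 z.2).mul_const (f z.1 * g z.2), ?_⟩
    have h1 : ∀ z : ℝ × ℝ, ∫ x, ‖Function.uncurry F (x, z)‖ =
        stableDensity α (t + t) (z.1 - z.2) * ‖f z.1 * g z.2‖ := by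
      intro z
      rw [← hconv, ← integral_mul_const]
      congr 1 with x
      simp only [Function.uncurry_apply_pair, F]
      rw [norm_mul, Real.norm_eq_abs, abs_of_nonneg (mul_nonneg
        (stableDensity_nonneg hα hα2 ht _) (stableDensity_nonneg hα hα2 ht _))]
    simp only [h1]
    refine hfg.norm.bdd_mul (c := stableDensity α (t + t) 0)
      (Continuous.aestronglyMeasurable (by fun_prop)) (ae_of_all _ fun z => ?_)
    rw [Real.norm_eq_abs, abs_of_nonneg (stableDensity_nonneg hα hα2 (add_pos ht ht) _)]
    exact stableDensity_le hα hα2 (add_pos ht ht) _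
  have hswap := integral_integral_swap hint
  have hL : ∀ x, stableSemigroup α t f x * stableSemigroup α t g x = ∫ z, F x z := by
    intro x
    rw [stableSemigroup, stableSemigroup, if_neg ht.ne', if_neg ht.ne',
      ← integral_prod_mul (μ := volume) (ν := volume)
        (fun y => stableDensity α t (x - y) * f y) (fun y => stableDensity α t (x - y) * g y)]
    congr 1 with z
    simp only [F]
    ring
  simp only [hL]
  rw [hswap]
  congr 1 with z
  simp only [F]
  rw [integral_mul_const, hconv]

/-! ### The coupling measure of the covariance functional -/

/-- The measure on the plane with density `p_t(x - y)`. Both of its marginals are Lebesgue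
measure, so that composition with a coordinate is an isometry from `L²(ℝ)` into `L²` of the plane
with this measure. -/
def couplingMeasure (α t : ℝ) : Measure (ℝ × ℝ) :=
  (volume : Measure (ℝ × ℝ)).withDensity fun z => ENNReal.ofReal (stableDensity α t (z.1 - z.2))

lemma lintegral_stableDensity {α t : ℝ} (hα : 0 < α) (hα2 : α ≤ 2) (ht : 0 < t) :
    ∫⁻ x, ENNReal.ofReal (stableDensity α t x) = 1 := by
  rw [← ofReal_integral_eq_lintegral_ofReal (integrable_stableDensity hα hα2 ht)
    (ae_of_all _ fun x => stableDensity_nonneg hα hα2 ht x), integral_stableDensity hα hα2 ht]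
  simp

lemma measurePreserving_fst_couplingMeasure {α t : ℝ} (hα : 0 < α) (hα2 : α ≤ 2) (ht : 0 < t) :
    MeasurePreserving Prod.fst (couplingMeasure α t) (volume : Measure ℝ) := by
  refine ⟨measurable_fst, ?_⟩
  have hpc := continuous_stableDensity hα ht
  ext s hs
  rw [Measure.map_apply measurable_fst hs, couplingMeasure,
    withDensity_apply _ (measurable_fst hs), ← Set.prod_univ, Measure.volume_eq_prod,
    ← Measure.prod_restrict, Measure.restrict_univ, lintegral_prod _ (by fun_prop)]
  have : ∀ x : ℝ, ∫⁻ y, ENNReal.ofReal (stableDensity α t (x - y)) = 1 := by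
    intro x
    rw [lintegral_sub_left_eq_self (fun y => ENNReal.ofReal (stableDensity α t y)),
      lintegral_stableDensity hα hα2 ht]
  simp [this]

lemma measurePreserving_swap_couplingMeasure (α t : ℝ) (hα : 0 < α) (ht : 0 < t) :
    MeasurePreserving Prod.swap (couplingMeasure α t) (couplingMeasure α t) := by
  refine ⟨measurable_swap, ?_⟩
  have hpc := continuous_stableDensity hα ht
  ext s hs
  have h := (Measure.measurePreserving_swap (μ := (volume : Measure ℝ)) (ν := (volume : Measure ℝ)))
  rw [Measure.map_apply measurable_swap hs, couplingMeasure,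
    withDensity_apply _ (measurable_swap hs), withDensity_apply _ hs, Measure.volume_eq_prod,
    ← h.setLIntegral_comp_preimage hs (by fun_prop)]
  refine setLIntegral_congr_fun (measurable_swap hs) fun z _ => ?_
  simp only [Prod.fst_swap, Prod.snd_swap]
  rw [← stableDensity_neg, neg_sub]

lemma measurePreserving_snd_couplingMeasure {α t : ℝ} (hα : 0 < α) (hα2 : α ≤ 2) (ht : 0 < t) :
    MeasurePreserving Prod.snd (couplingMeasure α t) (volume : Measure ℝ) :=
  (measurePreserving_fst_couplingMeasure hα hα2 ht).comp
    (measurePreserving_swap_couplingMeasure α t hα ht)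

lemma integral_couplingMeasure {α t : ℝ} (hα : 0 < α) (hα2 : α ≤ 2) (ht : 0 < t)
    (F : ℝ × ℝ → ℝ) :
    ∫ z, F z ∂(couplingMeasure α t) = ∫ z : ℝ × ℝ, stableDensity α t (z.1 - z.2) * F z := by
  have hpc := continuous_stableDensity hα ht
  rw [couplingMeasure, integral_withDensity_eq_integral_toReal_smul (by fun_prop)
    (ae_of_all _ fun _ => ENNReal.ofReal_lt_top)]
  congr 1 with z
  rw [ENNReal.toReal_ofReal (stableDensity_nonneg hα hα2 ht _), smul_eq_mul]

/-! ### Convergence of bilinear integrals -/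

lemma inner_toLp {S : Type*} [MeasurableSpace S] {μ : Measure S} {f g : S → ℝ}
    (hf : MemLp f 2 μ) (hg : MemLp g 2 μ) :
    inner ℝ (hf.toLp f) (hg.toLp g) = ∫ x, f x * g x ∂μ := by
  rw [L2.inner_def]
  refine integral_congr_ae ?_
  filter_upwards [hf.coeFn_toLp, hg.coeFn_toLp] with x h1 h2
  rw [h1, h2, real_inner_eq_re_inner, RCLike.inner_apply]
  simp [mul_comm]

lemma tendsto_integral_mul {S : Type*} [MeasurableSpace S] {μ : Measure S} {F G : ℕ → S → ℝ}
    {f g : S → ℝ} (hF : ∀ n, MemLp (F n) 2 μ) (hG : ∀ n, MemLp (G n) 2 μ) (hf : MemLp f 2 μ)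
    (hg : MemLp g 2 μ) (hFf : Tendsto (fun n => eLpNorm (fun x => F n x - f x) 2 μ) atTop (𝓝 0))
    (hGg : Tendsto (fun n => eLpNorm (fun x => G n x - g x) 2 μ) atTop (𝓝 0)) :
    Tendsto (fun n => ∫ x, F n x * G n x ∂μ) atTop (𝓝 (∫ x, f x * g x ∂μ)) := by
  have h1 := (Lp.tendsto_Lp_iff_tendsto_eLpNorm'' F hF f hf).2 hFf
  have h2 := (Lp.tendsto_Lp_iff_tendsto_eLpNorm'' G hG g hg).2 hGg
  have h3 := h1.inner (𝕜 := ℝ) h2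
  simpa only [inner_toLp] using h3

/-! ### The covariance form -/

/-- The covariance of `⟨X(1), f⟩` and `⟨X(1), g⟩`, with the smoothing term written as an integral
against the coupling measure at time `2`. -/
def covForm (α m v : ℝ) (f g : ℝ → ℝ) : ℝ :=
  m * (∫ x, f x * g x) + (v - m) * ∫ z, f z.1 * g z.2 ∂(couplingMeasure α 2)

section covForm

variable {α m v : ℝ} {f g : ℝ → ℝ}

lemma covForm_eq (hα : 0 < α) (hα2 : α ≤ 2) (f g : ℝ → ℝ) :
    covForm α m v f g = m * (∫ x, f x * g x) +
      (v - m) * ∫ z : ℝ × ℝ, stableDensity α 2 (z.1 - z.2) * (f z.1 * g z.2) := by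
  rw [covForm, integral_couplingMeasure hα hα2 two_pos]

lemma memLp_comp_fst (hα : 0 < α) (hα2 : α ≤ 2) (hf : MemLp f 2) :
    MemLp (fun z : ℝ × ℝ => f z.1) 2 (couplingMeasure α 2) :=
  hf.comp_measurePreserving (measurePreserving_fst_couplingMeasure hα hα2 two_pos)

lemma memLp_comp_snd (hα : 0 < α) (hα2 : α ≤ 2) (hf : MemLp f 2) :
    MemLp (fun z : ℝ × ℝ => f z.2) 2 (couplingMeasure α 2) :=
  hf.comp_measurePreserving (measurePreserving_snd_couplingMeasure hα hα2 two_pos)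

/-- The covariance form is continuous on `L²(ℝ)`. -/
lemma tendsto_covForm (hα : 0 < α) (hα2 : α ≤ 2) (m v : ℝ) {F G : ℕ → ℝ → ℝ}
    (hF : ∀ n, MemLp (F n) 2) (hG : ∀ n, MemLp (G n) 2) (hf : MemLp f 2) (hg : MemLp g 2)
    (hFf : Tendsto (fun n => eLpNorm (fun x => F n x - f x) 2 volume) atTop (𝓝 0))
    (hGg : Tendsto (fun n => eLpNorm (fun x => G n x - g x) 2 volume) atTop (𝓝 0)) :
    Tendsto (fun n => covForm α m v (F n) (G n)) atTop (𝓝 (covForm α m v f g)) := by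
  refine ((tendsto_integral_mul hF hG hf hg hFf hGg).const_mul m).add (Tendsto.const_mul _ ?_)
  refine tendsto_integral_mul (F := fun n z => F n z.1) (G := fun n z => G n z.2)
    (fun n => memLp_comp_fst hα hα2 (hF n)) (fun n => memLp_comp_snd hα hα2 (hG n))
    (memLp_comp_fst hα hα2 hf) (memLp_comp_snd hα hα2 hg) (hFf.congr fun n => ?_)
    (hGg.congr fun n => ?_)
  · exact (eLpNorm_comp_measurePreserving (g := fun x => F n x - f x)
      ((hF n).sub hf).aestronglyMeasurable
      (measurePreserving_fst_couplingMeasure hα hα2 two_pos)).symm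
  · exact (eLpNorm_comp_measurePreserving (g := fun x => G n x - g x)
      ((hG n).sub hg).aestronglyMeasurable
      (measurePreserving_snd_couplingMeasure hα hα2 two_pos)).symm

/-- The covariance form is bounded on `L²(ℝ)`, by `2 |a b| ≤ a ^ 2 + b ^ 2` and the marginals. -/
lemma covForm_self_le (hα : 0 < α) (hα2 : α ≤ 2) (m v : ℝ) (hf : MemLp f 2) :
    covForm α m v f f ≤ (|m| + |v - m|) * ∫ x, f x ^ 2 := by
  have h1 := measurePreserving_fst_couplingMeasure hα hα2 two_pos
  have h2 := measurePreserving_snd_couplingMeasure hα hα2 two_pos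
  have hsq : ∀ x, f x * f x = f x ^ 2 := fun x => (pow_two _).symm
  have hi1 := (memLp_comp_fst hα hα2 hf).integrable_sq
  have hi2 := (memLp_comp_snd hα hα2 hf).integrable_sq
  have e1 : ∫ z, f z.1 ^ 2 ∂(couplingMeasure α 2) = ∫ x, f x ^ 2 := by
    rw [← h1.map_eq, integral_map h1.measurable.aemeasurable]
    rw [h1.map_eq]
    exact hf.integrable_sq.aestronglyMeasurable
  have e2 : ∫ z, f z.2 ^ 2 ∂(couplingMeasure α 2) = ∫ x, f x ^ 2 := by
    rw [← h2.map_eq, integral_map h2.measurable.aemeasurable]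
    rw [h2.map_eq]
    exact hf.integrable_sq.aestronglyMeasurable
  have h3 : |∫ z, f z.1 * f z.2 ∂(couplingMeasure α 2)| ≤ ∫ x, f x ^ 2 := by
    have h4 : ∫ z, (f z.1 ^ 2 + f z.2 ^ 2) / 2 ∂(couplingMeasure α 2) = ∫ x, f x ^ 2 := by
      rw [integral_div, integral_add hi1 hi2, e1, e2]
      ring
    rw [← h4]
    refine (abs_integral_le_integral_abs).trans (integral_mono_of_nonneg
      (ae_of_all _ fun z => abs_nonneg _) ((hi1.add hi2).div_const 2) (ae_of_all _ fun z => ?_))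
    rw [abs_le]
    constructor <;> nlinarith [sq_nonneg (f z.1 + f z.2), sq_nonneg (f z.1 - f z.2)]
  rw [covForm]
  simp only [hsq]
  have hI : 0 ≤ ∫ x, f x ^ 2 := integral_nonneg fun x => sq_nonneg _
  have e3 : m * ∫ x, f x ^ 2 ≤ |m| * ∫ x, f x ^ 2 :=
    mul_le_mul_of_nonneg_right (le_abs_self m) hI
  have e4 : (v - m) * ∫ z, f z.1 * f z.2 ∂(couplingMeasure α 2) ≤ |v - m| * ∫ x, f x ^ 2 :=
    (le_abs_self _).trans (by rw [abs_mul]; gcongr)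
  linarith

lemma covForm_shift (hα : 0 < α) (hα2 : α ≤ 2) (m v : ℝ) (f g : ℝ → ℝ) (a : ℝ) :
    covForm α m v (fun x => f (x - a)) (fun x => g (x - a)) = covForm α m v f g := by
  rw [covForm_eq hα hα2, covForm_eq hα hα2]
  congr 2
  · exact integral_sub_right_eq_self (fun x => f x * g x) a
  · have := integral_sub_right_eq_self (μ := (volume : Measure (ℝ × ℝ)))
      (fun z : ℝ × ℝ => stableDensity α 2 (z.1 - z.2) * (f z.1 * g z.2)) (a, a)
    rw [← this]
    congr 1 with z
    simp

end covForm

/-! ### The extension of the random field to square integrable functions -/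

variable {Ω : Type*} [MeasurableSpace Ω] {P : Measure Ω}
  {α m v : ℝ} {X : ℝ≥0 → Ω → (𝓢(ℝ, ℝ) →L[ℝ] ℝ)}

namespace IsDensityProcess

lemma hasGaussianLaw (hX : IsDensityProcess P α m v X) (φ : 𝓢(ℝ, ℝ)) :
    HasGaussianLaw (fun ω => X 1 ω φ) P :=
  hX.gaussian.hasGaussianLaw_eval (1, φ)

lemma memLp (hX : IsDensityProcess P α m v X) (φ : 𝓢(ℝ, ℝ)) : MemLp (fun ω => X 1 ω φ) 2 P :=
  (hX.hasGaussianLaw φ).memLp_two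

lemma integral_mul (hX : IsDensityProcess P α m v X) (hα : 0 < α) (hα2 : α ≤ 2)
    (φ ψ : 𝓢(ℝ, ℝ)) : ∫ ω, X 1 ω φ * X 1 ω ψ ∂P = covForm α m v φ ψ := by
  rw [hX.covariance, covForm_eq hα hα2, NNReal.coe_one,
    integral_stableSemigroup_mul hα hα2 one_pos φ.integrable ψ.integrable]
  simp [stableSemigroup, one_add_one_eq_two]

lemma map_eq (hX : IsDensityProcess P α m v X) (hα : 0 < α) (hα2 : α ≤ 2) (φ : 𝓢(ℝ, ℝ)) :
    P.map (fun ω => X 1 ω φ) = gaussianReal 0 (covForm α m v φ φ).toNNReal := by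
  rw [(hX.hasGaussianLaw φ).map_eq_gaussianReal, hX.centered,
    variance_of_integral_eq_zero (hX.measurable 1 φ).aemeasurable (hX.centered 1 φ),
    ← hX.integral_mul hα hα2]
  simp only [pow_two]

end IsDensityProcess

namespace IsL2Extension

variable {f g : ℝ → ℝ} {Z W : Ω → ℝ}

lemma of_schwartz (hX : IsDensityProcess P α m v X) (φ : 𝓢(ℝ, ℝ)) :
    IsL2Extension P (X 1) φ fun ω => X 1 ω φ :=
  ⟨hX.measurable 1 φ, hX.memLp φ, fun _ => φ, by simp, by simp⟩

lemma add (hX : IsDensityProcess P α m v X) (hf : MemLp f 2) (hg : MemLp g 2)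
    (h : IsL2Extension P (X 1) f Z) (h' : IsL2Extension P (X 1) g W) :
    IsL2Extension P (X 1) (fun x => f x + g x) fun ω => Z ω + W ω := by
  obtain ⟨h1, h2, φ, h3, h4⟩ := h
  obtain ⟨h1', h2', ψ, h3', h4'⟩ := h'
  refine ⟨h1.add h1', h2.add h2', fun n => φ n + ψ n, ?_, ?_⟩
  · refine tendsto_of_tendsto_of_tendsto_of_le_of_le tendsto_const_nhds
      (by simpa using h3.add h3') (fun n => zero_le) fun n => ?_
    refine le_trans (le_of_eq ?_) (eLpNorm_add_le
      (((φ n).memLp 2).sub hf).aestronglyMeasurable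
      (((ψ n).memLp 2).sub hg).aestronglyMeasurable one_le_two)
    congr 1 with x
    simp only [add_apply, Pi.add_apply]
    ring
  · refine tendsto_of_tendsto_of_tendsto_of_le_of_le tendsto_const_nhds
      (by simpa using h4.add h4') (fun n => zero_le) fun n => ?_
    refine le_trans (le_of_eq ?_) (eLpNorm_add_le
      ((hX.memLp (φ n)).sub h2).aestronglyMeasurable
      ((hX.memLp (ψ n)).sub h2').aestronglyMeasurable one_le_two)
    congr 1 with ω
    simp only [map_add, Pi.add_apply]
    ring

lemma const_mul (c : ℝ) (h : IsL2Extension P (X 1) f Z) :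
    IsL2Extension P (X 1) (fun x => c * f x) fun ω => c * Z ω := by
  obtain ⟨h1, h2, φ, h3, h4⟩ := h
  refine ⟨h1.const_mul c, h2.const_mul c, fun n => c • φ n, ?_, ?_⟩
  · have := ENNReal.Tendsto.const_mul (a := ‖c‖ₑ) h3 (Or.inr enorm_ne_top)
    rw [mul_zero] at this
    refine this.congr fun n => ?_
    rw [← eLpNorm_const_smul]
    congr 1 with x
    simp only [Pi.smul_apply, smul_eq_mul, smul_apply]
    ring
  · have := ENNReal.Tendsto.const_mul (a := ‖c‖ₑ) h4 (Or.inr enorm_ne_top)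
    rw [mul_zero] at this
    refine this.congr fun n => ?_
    rw [← eLpNorm_const_smul]
    congr 1 with ω
    simp only [Pi.smul_apply, smul_eq_mul, map_smul]
    ring

lemma sub (hX : IsDensityProcess P α m v X) (hf : MemLp f 2) (hg : MemLp g 2)
    (h : IsL2Extension P (X 1) f Z) (h' : IsL2Extension P (X 1) g W) :
    IsL2Extension P (X 1) (fun x => f x - g x) fun ω => Z ω - W ω := by
  have := h.add hX hf (hg.const_mul (-1)) (h'.const_mul (-1))
  simpa [sub_eq_add_neg] using this

lemma sum (hX : IsDensityProcess P α m v X) {ι : Type*} (s : Finset ι) (c : ι → ℝ)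
    {f : ι → ℝ → ℝ} {Z : ι → Ω → ℝ} (hf : ∀ i, MemLp (f i) 2)
    (h : ∀ i, IsL2Extension P (X 1) (f i) (Z i)) :
    MemLp (fun x => ∑ i ∈ s, c i * f i x) 2 ∧
      IsL2Extension P (X 1) (fun x => ∑ i ∈ s, c i * f i x) fun ω => ∑ i ∈ s, c i * Z i ω := by
  classical
  refine ⟨memLp_finsetSum s fun i _ => (hf i).const_mul (c i), ?_⟩
  induction s using Finset.induction_on with
  | empty =>
    simp only [Finset.sum_empty]
    have := of_schwartz hX (0 : 𝓢(ℝ, ℝ))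
    simpa [Pi.zero_def] using this
  | insert a s ha ih =>
    simp only [Finset.sum_insert ha]
    exact ((h a).const_mul (c a)).add hX ((hf a).const_mul (c a))
      (memLp_finsetSum s fun i _ => (hf i).const_mul (c i)) ih

/-- The covariance functional extends to the `L²`-extension. -/
lemma integral_mul (hX : IsDensityProcess P α m v X) (hα : 0 < α) (hα2 : α ≤ 2)
    (hf : MemLp f 2) (hg : MemLp g 2)
    (h : IsL2Extension P (X 1) f Z) (h' : IsL2Extension P (X 1) g W) :
    ∫ ω, Z ω * W ω ∂P = covForm α m v f g := by
  obtain ⟨h1, h2, φ, h3, h4⟩ := h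
  obtain ⟨h1', h2', ψ, h3', h4'⟩ := h'
  have hlim := tendsto_integral_mul (fun n => hX.memLp (φ n)) (fun n => hX.memLp (ψ n)) h2 h2'
    h4 h4'
  have hlim2 := tendsto_covForm hα hα2 m v (fun n => (φ n).memLp 2) (fun n => (ψ n).memLp 2)
    hf hg h3 h3'
  simp only [hX.integral_mul hα hα2] at hlim
  exact tendsto_nhds_unique hlim hlim2

/-- The law of the extension is the limit of the Gaussian laws of the approximations. -/
lemma map_eq (hX : IsDensityProcess P α m v X) (hα : 0 < α) (hα2 : α ≤ 2)
    (hf : MemLp f 2) (h : IsL2Extension P (X 1) f Z) :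
    P.map Z = gaussianReal 0 (covForm α m v f f).toNNReal := by
  have := hX.gaussian.isProbabilityMeasure
  obtain ⟨h1, h2, φ, h3, h4⟩ := h
  have hcov := tendsto_covForm hα hα2 m v (fun n => (φ n).memLp 2) (fun n => (φ n).memLp 2)
    hf hf h3 h3
  have hmeas := tendstoInMeasure_of_tendsto_eLpNorm (p := 2) two_ne_zero
    (fun n => (hX.memLp (φ n)).aestronglyMeasurable) h2.aestronglyMeasurable h4
  obtain ⟨ns, hns, hae⟩ := hmeas.exists_seq_tendsto_ae
  have : IsProbabilityMeasure (P.map Z) := Measure.isProbabilityMeasure_map h1.aemeasurable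
  refine Measure.ext_of_charFun (funext fun s => ?_)
  have hchar : ∀ {V : Ω → ℝ}, Measurable V →
      charFun (P.map V) s = ∫ ω, Complex.exp (s * V ω * Complex.I) ∂P := by
    intro V hV
    rw [charFun_apply_real, integral_map hV.aemeasurable]
    exact Continuous.aestronglyMeasurable (by fun_prop)
  have hA : Tendsto (fun k => charFun (P.map fun ω => X 1 ω (φ (ns k))) s) atTop
      (𝓝 (charFun (P.map Z) s)) := by
    simp only [hchar h1, hchar (hX.measurable 1 _)]
    refine tendsto_integral_of_dominated_convergence (fun _ => 1) (fun n => ?_)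
      (integrable_const _) (fun n => ae_of_all _ fun ω => ?_) ?_
    · have := hX.measurable 1 (φ (ns n))
      exact Measurable.aestronglyMeasurable (by fun_prop)
    · rw [← Complex.ofReal_mul, Complex.norm_exp_ofReal_mul_I]
    · filter_upwards [hae] with ω hω
      have hcont : Continuous fun x : ℝ => Complex.exp (s * x * Complex.I) := by fun_prop
      exact (hcont.tendsto _).comp hω
  have hB : Tendsto (fun k => charFun (P.map fun ω => X 1 ω (φ (ns k))) s) atTop
      (𝓝 (charFun (gaussianReal 0 (covForm α m v f f).toNNReal) s)) := by
    simp only [hX.map_eq hα hα2, charFun_gaussianReal]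
    have hc : Continuous fun x : ℝ => Complex.exp (s * (0 : ℝ) * Complex.I -
        ((x.toNNReal : ℝ) : ℂ) * s ^ 2 / 2) := by fun_prop
    exact (hc.tendsto _).comp (hcov.comp hns.tendsto_atTop)
  exact tendsto_nhds_unique hA hB

lemma covForm_nonneg (hX : IsDensityProcess P α m v X) (hα : 0 < α) (hα2 : α ≤ 2)
    (hf : MemLp f 2) (h : IsL2Extension P (X 1) f Z) : 0 ≤ covForm α m v f f := by
  rw [← h.integral_mul hX hα hα2 hf hf h]
  exact integral_nonneg fun ω => mul_self_nonneg _

lemma integral_eq_zero (hX : IsDensityProcess P α m v X) (hα : 0 < α) (hα2 : α ≤ 2)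
    (hf : MemLp f 2) (h : IsL2Extension P (X 1) f Z) : ∫ ω, Z ω ∂P = 0 := by
  have h1 : ∫ x, x ∂(P.map Z) = 0 := by rw [h.map_eq hX hα hα2 hf, integral_id_gaussianReal]
  rwa [integral_map (f := fun x => x) h.1.aemeasurable aestronglyMeasurable_id] at h1

lemma covariance_eq (hX : IsDensityProcess P α m v X) (hα : 0 < α) (hα2 : α ≤ 2)
    (hf : MemLp f 2) (hg : MemLp g 2)
    (h : IsL2Extension P (X 1) f Z) (h' : IsL2Extension P (X 1) g W) :
    ProbabilityTheory.covariance Z W P = covForm α m v f g := by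
  have := hX.gaussian.isProbabilityMeasure
  rw [covariance_eq_sub h.2.1 h'.2.1, h.integral_eq_zero hX hα hα2 hf, zero_mul, sub_zero]
  exact h.integral_mul hX hα hα2 hf hg h'

end IsL2Extension

/-- Schwartz functions are dense in `L²(ℝ)`, and `φ ↦ ⟨X(1), φ⟩` is Lipschitz from `L²(ℝ)` to
`L²(P)`. -/
lemma exists_isL2Extension (hX : IsDensityProcess P α m v X) (hα : 0 < α) (hα2 : α ≤ 2)
    {f : ℝ → ℝ} (hf : MemLp f 2) : ∃ Z : Ω → ℝ, IsL2Extension P (X 1) f Z := by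
  have hdense := SchwartzMap.denseRange_toLpCLM (E := ℝ) (F := ℝ) (p := 2) ENNReal.ofNat_ne_top
    (μ := (volume : Measure ℝ))
  obtain ⟨u, hu, hulim⟩ := mem_closure_iff_seq_limit.1 (hdense (hf.toLp f))
  choose φ hφ using hu
  have hφ' : ∀ n, ((φ n).memLp 2).toLp (φ n) = u n := fun n => hφ n
  replace hulim : Tendsto (fun n => ((φ n).memLp 2 (μ := volume)).toLp (φ n)) atTop
      (𝓝 (hf.toLp f)) := hulim.congr fun n => (hφ' n).symm
  have h3 := (Lp.tendsto_Lp_iff_tendsto_eLpNorm'' (fun n => φ n) (fun n => (φ n).memLp 2) f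
    hf).1 hulim
  let U : ℕ → Lp ℝ 2 P := fun n => (hX.memLp (φ n)).toLp _
  have hdist : ∀ n k, dist (U n) (U k) ≤ Real.sqrt (|m| + |v - m|) *
      dist (((φ n).memLp 2 (μ := volume)).toLp (φ n)) (((φ k).memLp 2 (μ := volume)).toLp (φ k)) := by
    intro n k
    have e1 : U n - U k = (hX.memLp (φ n - φ k)).toLp _ := by
      rw [← MemLp.toLp_sub]
      congr 1 with ω
      simp
    have e2 : ((φ n).memLp 2 (μ := volume)).toLp (φ n) -
        ((φ k).memLp 2 (μ := volume)).toLp (φ k) =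
        ((φ n - φ k).memLp 2 (μ := volume)).toLp (φ n - φ k) := by
      rw [← MemLp.toLp_sub]
      rfl
    rw [dist_eq_norm, dist_eq_norm, e1, e2, ← sq_le_sq₀ (norm_nonneg _) (by positivity), mul_pow,
      Real.sq_sqrt (by positivity), ← real_inner_self_eq_norm_sq, ← real_inner_self_eq_norm_sq,
      inner_toLp, inner_toLp, hX.integral_mul hα hα2]
    refine (covForm_self_le hα hα2 m v ((φ n - φ k).memLp 2)).trans (le_of_eq ?_)
    simp only [pow_two]
  have hcau : CauchySeq U := by
    have h0 := cauchySeq_iff_tendsto_dist_atTop_0.1 hulim.cauchySeq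
    refine cauchySeq_iff_tendsto_dist_atTop_0.2 (squeeze_zero (fun _ => dist_nonneg)
      (fun n => hdist n.1 n.2) ?_)
    simpa using h0.const_mul (Real.sqrt (|m| + |v - m|))
  obtain ⟨Z, hZ⟩ := cauchySeq_tendsto_of_complete hcau
  refine ⟨Z, (Lp.stronglyMeasurable Z).measurable, Lp.memLp Z, φ, h3, ?_⟩
  refine (Lp.tendsto_Lp_iff_tendsto_eLpNorm'' (fun n ω => X 1 ω (φ n)) (fun n => hX.memLp (φ n))
    Z (Lp.memLp Z)).1 ?_
  rwa [Lp.toLp_coeFn]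

lemma isL2Extension_extPairing (hX : IsDensityProcess P α m v X) (hα : 0 < α) (hα2 : α ≤ 2)
    {f : ℝ → ℝ} (hf : MemLp f 2) : IsL2Extension P (X 1) f (extPairing P (X 1) f) := by
  have h := exists_isL2Extension hX hα hα2 hf
  rw [extPairing, dif_pos h]
  exact h.choose_spec

lemma strongDual_apply_eq_sum {ι : Type*} [Fintype ι] [DecidableEq ι] (L : StrongDual ℝ (ι → ℝ))
    (q : ι → ℝ) : L q = ∑ i, L (Pi.single i 1) * q i := by
  conv_lhs => rw [← Finset.univ_sum_single q]
  rw [map_sum]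
  refine Finset.sum_congr rfl fun i _ => ?_
  rw [show Pi.single i (q i) = q i • Pi.single (M := fun _ => ℝ) i 1 by
    rw [← Pi.single_smul, smul_eq_mul, mul_one], map_smul, smul_eq_mul, mul_comm]

/-- A finite family of extensions is jointly Gaussian. -/
lemma hasGaussianLaw_pi (hX : IsDensityProcess P α m v X) (hα : 0 < α) (hα2 : α ≤ 2)
    {ι : Type*} [Fintype ι] {f : ι → ℝ → ℝ} {Z : ι → Ω → ℝ} (hf : ∀ i, MemLp (f i) 2)
    (h : ∀ i, IsL2Extension P (X 1) (f i) (Z i)) : HasGaussianLaw (fun ω i => Z i ω) P where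
  isGaussian_map := by
    classical
    refine isGaussian_of_map_eq_gaussianReal fun L => ?_
    have hm : Measurable fun ω i => Z i ω := measurable_pi_lambda _ fun i => (h i).1
    obtain ⟨h1, h2⟩ := IsL2Extension.sum hX Finset.univ (fun i => L (Pi.single i 1)) hf h
    refine ⟨_, _, Eq.trans ?_ (h2.map_eq hX hα hα2 h1)⟩
    rw [Measure.map_map (by fun_prop) hm]
    congr 1 with ω
    simp only [Function.comp_apply]
    exact strongDual_apply_eq_sum L _

/-- Finite families of extensions have equal joint laws as soon as the covariance form takes equal
values on all corresponding linear combinations. -/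
lemma map_pi_eq (hX : IsDensityProcess P α m v X) (hα : 0 < α) (hα2 : α ≤ 2)
    {ι : Type*} [Fintype ι] {f g : ι → ℝ → ℝ} {Z W : ι → Ω → ℝ} (hf : ∀ i, MemLp (f i) 2)
    (hg : ∀ i, MemLp (g i) 2) (h : ∀ i, IsL2Extension P (X 1) (f i) (Z i))
    (h' : ∀ i, IsL2Extension P (X 1) (g i) (W i))
    (hcov : ∀ c : ι → ℝ, covForm α m v (fun x => ∑ i, c i * f i x) (fun x => ∑ i, c i * f i x) =
      covForm α m v (fun x => ∑ i, c i * g i x) (fun x => ∑ i, c i * g i x)) :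
    P.map (fun ω i => Z i ω) = P.map (fun ω i => W i ω) := by
  classical
  have hmZ : Measurable fun ω i => Z i ω := measurable_pi_lambda _ fun i => (h i).1
  have hmW : Measurable fun ω i => W i ω := measurable_pi_lambda _ fun i => (h' i).1
  have := hX.gaussian.isProbabilityMeasure
  have := Measure.isProbabilityMeasure_map (μ := P) hmZ.aemeasurable
  have := Measure.isProbabilityMeasure_map (μ := P) hmW.aemeasurable
  refine Measure.ext_of_charFunDual (funext fun L => ?_)
  rw [charFunDual_eq_charFun_map_one, charFunDual_eq_charFun_map_one]
  congr 1
  obtain ⟨h1, h2⟩ := IsL2Extension.sum hX Finset.univ (fun i => L (Pi.single i 1)) hf h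
  obtain ⟨h1', h2'⟩ := IsL2Extension.sum hX Finset.univ (fun i => L (Pi.single i 1)) hg h'
  rw [Measure.map_map (by fun_prop) hmZ, Measure.map_map (by fun_prop) hmW]
  have e1 : (L ∘ fun ω i => Z i ω) = fun ω => ∑ i, L (Pi.single i 1) * Z i ω :=
    funext fun ω => strongDual_apply_eq_sum L _
  have e2 : (L ∘ fun ω i => W i ω) = fun ω => ∑ i, L (Pi.single i 1) * W i ω :=
    funext fun ω => strongDual_apply_eq_sum L _
  rw [e1, e2, h2.map_eq hX hα hα2 h1, h2'.map_eq hX hα hα2 h1', hcov]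

/-! ### Dyadic chaining -/

/-- The dyadic point `k / 2 ^ n`. -/
def dyadicPt (n k : ℕ) : ℝ≥0 := (k : ℝ≥0) / 2 ^ n

/-- The largest dyadic point of level `n` that is at most `t`. -/
def dyadicFloor (n : ℕ) (t : ℝ≥0) : ℝ≥0 := dyadicPt n ⌊2 ^ n * (t : ℝ)⌋₊

lemma dyadicPt_succ_two_mul (n k : ℕ) : dyadicPt (n + 1) (2 * k) = dyadicPt n k := by
  unfold dyadicPt
  rw [pow_succ', Nat.cast_mul, Nat.cast_ofNat, mul_div_mul_left _ _ two_ne_zero]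

lemma coe_dyadicPt (n k : ℕ) : (dyadicPt n k : ℝ) = k / 2 ^ n := by simp [dyadicPt]

lemma dyadicFloor_le (n : ℕ) (t : ℝ≥0) : dyadicFloor n t ≤ t := by
  rw [← NNReal.coe_le_coe, dyadicFloor, coe_dyadicPt, div_le_iff₀ (by positivity), mul_comm]
  exact Nat.floor_le (by positivity)

lemma sub_dyadicFloor_le (n : ℕ) (t : ℝ≥0) : (t : ℝ) - dyadicFloor n t ≤ (1 / 2) ^ n := by
  have h := Nat.lt_floor_add_one (2 ^ n * (t : ℝ))
  have h2 : (2 : ℝ) ^ n * (1 / 2) ^ n = 1 := by rw [← mul_pow]; norm_num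
  rw [dyadicFloor, coe_dyadicPt, sub_le_iff_le_add, ← mul_le_mul_iff_right₀ (pow_pos two_pos n),
    mul_add, h2, mul_div_cancel₀ _ (by positivity)]
  linarith

section Chaining

variable {x : ℝ≥0 → ℝ} {r C : ℝ} {N : ℕ}

lemma floor_lt_of_lt {n N : ℕ} {t : ℝ≥0} (ht : t < N) : ⌊2 ^ n * (t : ℝ)⌋₊ < N * 2 ^ n := by
  rw [Nat.floor_lt (by positivity)]
  have : (t : ℝ) < N := by exact_mod_cast ht
  push_cast
  rw [mul_comm]
  gcongr

lemma dist_dyadicFloor_succ_le (hC : 0 ≤ C) (hr : 0 < r)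
    (h : ∀ n k, k < N * 2 ^ n → |x (dyadicPt n (k + 1)) - x (dyadicPt n k)| ≤ C * r ^ n)
    {t : ℝ≥0} (ht : t < N) (n : ℕ) :
    dist (x (dyadicFloor n t)) (x (dyadicFloor (n + 1) t)) ≤ C * r * r ^ n := by
  set k := ⌊2 ^ (n + 1) * (t : ℝ)⌋₊ with hk
  have hk2 : ⌊2 ^ n * (t : ℝ)⌋₊ = k / 2 := by
    rw [hk, ← Nat.floor_div_natCast]
    congr 1
    push_cast
    ring
  have hkN : k < N * 2 ^ (n + 1) := floor_lt_of_lt ht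
  rw [dyadicFloor, dyadicFloor, hk2, ← hk, ← dyadicPt_succ_two_mul, dist_comm, Real.dist_eq]
  rcases Nat.mod_two_eq_zero_or_one k with hmod | hmod
  · rw [show 2 * (k / 2) = k by omega]
    simp only [sub_self, abs_zero]
    positivity
  · have := h (n + 1) (2 * (k / 2)) (by omega)
    rw [show 2 * (k / 2) + 1 = k by omega] at this
    rw [mul_assoc, ← pow_succ']
    exact this

lemma abs_sub_dyadicFloor_le (hC : 0 ≤ C) (hr : 0 < r)
    (h : ∀ n k, k < N * 2 ^ n → |x (dyadicPt n (k + 1)) - x (dyadicPt n k)| ≤ C * r ^ n)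
    {s t : ℝ≥0} (hst : s ≤ t) (ht : t < N) {n : ℕ} (hd : (t : ℝ) - s ≤ (1 / 2) ^ n) :
    |x (dyadicFloor n t) - x (dyadicFloor n s)| ≤ C * r ^ n := by
  have hs : s < N := hst.trans_lt ht
  have h2 : (2 : ℝ) ^ n * (1 / 2) ^ n = 1 := by rw [← mul_pow]; norm_num
  have h1 : ⌊2 ^ n * (s : ℝ)⌋₊ ≤ ⌊2 ^ n * (t : ℝ)⌋₊ := by
    refine Nat.floor_le_floor ?_
    gcongr
  have h3 : ⌊2 ^ n * (t : ℝ)⌋₊ ≤ ⌊2 ^ n * (s : ℝ)⌋₊ + 1 := by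
    rw [← Nat.floor_add_one (by positivity)]
    refine Nat.floor_le_floor ?_
    have := mul_le_mul_of_nonneg_left hd (pow_pos two_pos n).le
    rw [h2] at this
    linarith
  rw [dyadicFloor, dyadicFloor]
  rcases h1.eq_or_lt with h4 | h4
  · rw [h4, sub_self, abs_zero]
    positivity
  · rw [show ⌊2 ^ n * (t : ℝ)⌋₊ = ⌊2 ^ n * (s : ℝ)⌋₊ + 1 by omega]
    exact h n _ (floor_lt_of_lt hs)

/-- The limit of the values of `x` along the dyadic approximations of `t` from below. -/
def dyadicLim (x : ℝ≥0 → ℝ) (t : ℝ≥0) : ℝ := limUnder atTop fun n => x (dyadicFloor n t)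

lemma tendsto_dyadicLim (hC : 0 ≤ C) (hr : 0 < r) (hr1 : r < 1)
    (h : ∀ n k, k < N * 2 ^ n → |x (dyadicPt n (k + 1)) - x (dyadicPt n k)| ≤ C * r ^ n)
    {t : ℝ≥0} (ht : t < N) :
    Tendsto (fun n => x (dyadicFloor n t)) atTop (𝓝 (dyadicLim x t)) :=
  (cauchySeq_of_le_geometric r (C * r) hr1 (dist_dyadicFloor_succ_le hC hr h ht)).tendsto_limUnder

/-- The chaining estimate: geometric control of the increments over neighbouring dyadic points
yields Hölder continuity of the limit path. -/
lemma exists_dyadicLim_holder {γ : ℝ} (hγ : 0 < γ) (hC : 0 ≤ C)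
    (h : ∀ n k, k < N * 2 ^ n →
      |x (dyadicPt n (k + 1)) - x (dyadicPt n k)| ≤ C * ((1 / 2 : ℝ) ^ γ) ^ n) :
    ∃ K : ℝ, 0 ≤ K ∧ ∀ s t : ℝ≥0, s ≤ t → t < N →
      |dyadicLim x t - dyadicLim x s| ≤ K * ((t : ℝ) - s) ^ γ := by
  set r : ℝ := (1 / 2 : ℝ) ^ γ with hrdef
  have hr : 0 < r := by positivity
  have hr1 : r < 1 := Real.rpow_lt_one (by norm_num) (by norm_num) hγ
  have h1r : 0 < 1 - r := by linarith
  set D : ℝ := C * r / (1 - r)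
  have hD : 0 ≤ D := by positivity
  have happ : ∀ t : ℝ≥0, t < N → ∀ n, |x (dyadicFloor n t) - dyadicLim x t| ≤ D * r ^ n := by
    intro t ht n
    have := dist_le_of_le_geometric_of_tendsto r (C * r) hr1 (dist_dyadicFloor_succ_le hC hr h ht)
      (tendsto_dyadicLim hC hr hr1 h ht) n
    rw [Real.dist_eq] at this
    refine this.trans (le_of_eq ?_)
    simp only [D]
    ring
  have hstep : ∀ (s t : ℝ≥0) (n : ℕ) (B : ℝ), s ≤ t → t < N →
      |x (dyadicFloor n t) - x (dyadicFloor n s)| ≤ B →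
      |dyadicLim x t - dyadicLim x s| ≤ B + 2 * D * r ^ n := by
    intro s t n B hst ht hB
    have e1 := happ t ht n
    have e2 := happ s (hst.trans_lt ht) n
    rw [abs_le] at *
    constructor <;> linarith [e1.1, e1.2, e2.1, e2.2, hB.1, hB.2]
  set S : ℝ := ∑ k ∈ Finset.range (N + 1), |x (dyadicPt 0 k)| with hS
  have hS0 : 0 ≤ S := Finset.sum_nonneg fun k _ => abs_nonneg _
  have hbound : ∀ t : ℝ≥0, t < N → |x (dyadicFloor 0 t)| ≤ S := by
    intro t ht
    have hk : ⌊2 ^ 0 * (t : ℝ)⌋₊ < N * 2 ^ 0 := floor_lt_of_lt ht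
    exact Finset.single_le_sum (f := fun k => |x (dyadicPt 0 k)|) (fun k _ => abs_nonneg _)
      (Finset.mem_range.2 (by omega))
  refine ⟨(C + 2 * D) / r + (2 * S + 2 * D), by positivity, fun s t hst ht => ?_⟩
  have hst' : (s : ℝ) ≤ t := hst
  rcases hst.eq_or_lt with rfl | hlt
  · simp only [sub_self, abs_zero]
    positivity
  have hlt' : (0 : ℝ) < t - s := sub_pos.2 hlt
  rcases le_or_gt ((t : ℝ) - s) 1 with hd | hd
  · obtain ⟨n, hn1, hn2⟩ := exists_nat_pow_near_of_lt_one hlt' hd (y := (1 / 2 : ℝ))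
      (by norm_num) (by norm_num)
    have e1 := hstep s t n _ hst ht (abs_sub_dyadicFloor_le hC hr h hst ht hn2)
    have e2 : r ^ (n + 1) ≤ ((t : ℝ) - s) ^ γ := by
      rw [hrdef, ← Real.rpow_natCast, ← Real.rpow_mul (by norm_num), mul_comm,
        Real.rpow_mul (by norm_num), Real.rpow_natCast]
      exact Real.rpow_le_rpow (by positivity) hn1.le hγ.le
    have e3 : (C + 2 * D) * r ^ n = (C + 2 * D) / r * r ^ (n + 1) := by
      rw [pow_succ]
      field_simp
    calc _ ≤ (C + 2 * D) * r ^ n := by linarith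
      _ = (C + 2 * D) / r * r ^ (n + 1) := e3
      _ ≤ (C + 2 * D) / r * ((t : ℝ) - s) ^ γ := by gcongr
      _ ≤ _ := by
        gcongr
        linarith
  · have e1 := hstep s t 0 (2 * S) hst ht (by
      have := hbound t ht
      have := hbound s (hst.trans_lt ht)
      rw [abs_le] at *
      constructor <;> linarith)
    have e2 : 1 ≤ ((t : ℝ) - s) ^ γ := Real.one_le_rpow hd.le hγ.le
    rw [pow_zero, mul_one] at e1
    have e3 : 0 ≤ (C + 2 * D) / r := by positivity
    calc _ ≤ (2 * S + 2 * D) * 1 := by linarith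
      _ ≤ (2 * S + 2 * D) * ((t : ℝ) - s) ^ γ := by gcongr
      _ ≤ _ := mul_le_mul_of_nonneg_right (le_add_of_nonneg_left e3) (by positivity)

/-- Bounds that hold for all fine dyadic levels hold for all levels at the cost of a constant. -/
lemma exists_const_of_eventually (hr : 0 < r)
    (h : ∀ᶠ n in atTop, ∀ k, k < N * 2 ^ n → |x (dyadicPt n (k + 1)) - x (dyadicPt n k)| ≤ r ^ n) :
    ∃ C : ℝ, 0 ≤ C ∧ ∀ n k, k < N * 2 ^ n →
      |x (dyadicPt n (k + 1)) - x (dyadicPt n k)| ≤ C * r ^ n := by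
  obtain ⟨n₀, hn₀⟩ := eventually_atTop.1 h
  let a : ℕ → ℕ → ℝ := fun n k => |x (dyadicPt n (k + 1)) - x (dyadicPt n k)| / r ^ n
  have ha : ∀ n k, 0 ≤ a n k := fun n k => by positivity
  set S := ∑ n ∈ Finset.range n₀, ∑ k ∈ Finset.range (N * 2 ^ n), a n k
  have hS : 0 ≤ S := Finset.sum_nonneg fun n _ => Finset.sum_nonneg fun k _ => ha n k
  refine ⟨1 + S, by positivity, fun n k hk => ?_⟩
  have hrn : 0 < r ^ n := by positivity
  rcases lt_or_ge n n₀ with hn | hn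
  · have h1 : a n k ≤ S :=
      (Finset.single_le_sum (f := fun k => a n k) (fun k _ => ha n k)
        (Finset.mem_range.2 hk)).trans
      (Finset.single_le_sum (f := fun n => ∑ k ∈ Finset.range (N * 2 ^ n), a n k)
        (fun n _ => Finset.sum_nonneg fun k _ => ha n k) (Finset.mem_range.2 hn))
    rw [← div_le_iff₀ hrn]
    exact h1.trans (by linarith)
  · refine (hn₀ n hn k hk).trans ?_
    nlinarith

end Chaining

/-! ### Hölder continuous versions of Gaussian processes -/

lemma integral_pow_gaussianReal (c : ℝ≥0) (p : ℕ) :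
    ∫ x, x ^ (2 * p) ∂(gaussianReal 0 c) = (c : ℝ) ^ p * ∫ x, x ^ (2 * p) ∂(gaussianReal 0 1) := by
  have h : gaussianReal 0 c = (gaussianReal 0 1).map (Real.sqrt c * ·) := by
    rw [gaussianReal_map_const_mul]
    congr 1
    · simp
    · ext
      simp
  rw [h, integral_map (by fun_prop) (by fun_prop), ← integral_const_mul]
  congr 1 with x
  rw [mul_pow, pow_mul, Real.sq_sqrt c.coe_nonneg]

lemma measureReal_abs_gt_le {Ω : Type*} [MeasurableSpace Ω] {P : Measure Ω}
    [IsProbabilityMeasure P] {Z : Ω → ℝ} (hZ : Measurable Z) {c : ℝ≥0}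
    (hlaw : P.map Z = gaussianReal 0 c) (p : ℕ) {a : ℝ} (ha : 0 < a) :
    P.real {ω | a < |Z ω|} ≤
      (c : ℝ) ^ p * (∫ x, x ^ (2 * p) ∂(gaussianReal 0 1)) / a ^ (2 * p) := by
  have hint : Integrable (fun x : ℝ => x ^ (2 * p)) (gaussianReal 0 c) := by
    have h := (memLp_id_gaussianReal (μ := 0) (v := c) ((2 * p : ℕ) : ℝ≥0)).integrable_norm_rpow'
    refine h.congr (ae_of_all _ fun x => ?_)
    simp only [id, ENNReal.coe_natCast, ENNReal.toReal_natCast,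
      Real.rpow_natCast, Real.norm_eq_abs]
    exact (even_two_mul p).pow_abs x
  have hint2 : Integrable (fun ω => Z ω ^ (2 * p)) P := by
    rw [← hlaw] at hint
    exact (integrable_map_measure (f := Z) (g := fun x : ℝ => x ^ (2 * p)) (by fun_prop)
      hZ.aemeasurable).1 hint
  have h := mul_meas_ge_le_integral_of_nonneg (μ := P) (f := fun ω => Z ω ^ (2 * p))
    (ae_of_all _ fun ω => (even_two_mul p).pow_nonneg _) hint2 (a ^ (2 * p))
  have h2 : ∫ ω, Z ω ^ (2 * p) ∂P = (c : ℝ) ^ p * ∫ x, x ^ (2 * p) ∂(gaussianReal 0 1) := by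
    rw [← integral_pow_gaussianReal, ← hlaw, integral_map hZ.aemeasurable (by fun_prop)]
  rw [h2] at h
  rw [le_div_iff₀ (by positivity), mul_comm]
  refine le_trans ?_ h
  refine mul_le_mul_of_nonneg_left (measureReal_mono (fun ω hω => ?_)) (by positivity)
  simp only [Set.mem_ofPred_eq] at hω ⊢
  rw [← (even_two_mul p).pow_abs (Z ω)]
  gcongr

section Version

variable {Ω : Type*} [MeasurableSpace Ω] {P : Measure Ω} [IsProbabilityMeasure P]
  {ξ : ℝ≥0 → Ω → ℝ} {V : ℝ≥0 → ℝ≥0 → ℝ≥0} {β : ℝ}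

/-- Borel–Cantelli for the dyadic increments: Markov's inequality with a moment of order `2 p` bounds
the probability at level `n` by a multiple of `2 ^ n (q / r ^ 2) ^ (p n)`, with `q = 2 ^ (-β)` and
`r = 2 ^ (-γ)`. This is summable for large `p`, because `γ < β / 2` means `q < r ^ 2`. -/
lemma ae_eventually_dyadic_increments_le (hm : ∀ t, Measurable (ξ t))
    (hlaw : ∀ s t, P.map (fun ω => ξ t ω - ξ s ω) = gaussianReal 0 (V s t))
    {N : ℕ} {K : ℝ} (hK : ∀ s t : ℝ≥0, s ≤ N → t ≤ N → (V s t : ℝ) ≤ K * |(t : ℝ) - s| ^ β)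
    {γ : ℝ} (hγβ : γ < β / 2) :
    ∀ᵐ ω ∂P, ∀ᶠ n in atTop, ∀ k, k < N * 2 ^ n →
      |ξ (dyadicPt n (k + 1)) ω - ξ (dyadicPt n k) ω| ≤ ((1 / 2 : ℝ) ^ γ) ^ n := by
  set r : ℝ := (1 / 2 : ℝ) ^ γ with hrdef
  set q : ℝ := (1 / 2 : ℝ) ^ β with hqdef
  have hr : 0 < r := by positivity
  have hq : 0 < q := by positivity
  have hqr : q / r ^ 2 < 1 := by
    rw [div_lt_one (by positivity), hrdef, hqdef, ← Real.rpow_natCast, ← Real.rpow_mul (by norm_num)]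
    exact Real.rpow_lt_rpow_of_exponent_gt (by norm_num) (by norm_num) (by push_cast; linarith)
  obtain ⟨p, hp⟩ := exists_pow_lt_of_lt_one (show (0 : ℝ) < 1 / 2 by norm_num) hqr
  set M : ℝ := ∫ x, x ^ (2 * p) ∂(gaussianReal 0 1)
  have hM : 0 ≤ M := integral_nonneg fun x => (even_two_mul p).pow_nonneg _
  set ρ : ℝ := 2 * (q / r ^ 2) ^ p with hρdef
  have hρ0 : 0 ≤ ρ := by positivity
  have hρ1 : ρ < 1 := by linarith
  let s : ℕ → Set Ω := fun n => ⋃ k ∈ Finset.range (N * 2 ^ n),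
    {ω | r ^ n < |ξ (dyadicPt n (k + 1)) ω - ξ (dyadicPt n k) ω|}
  have hle : ∀ n, P (s n) ≤ ENNReal.ofReal ((N * |K| ^ p * M) * ρ ^ n) := by
    intro n
    have hk : ∀ k ∈ Finset.range (N * 2 ^ n),
        P {ω | r ^ n < |ξ (dyadicPt n (k + 1)) ω - ξ (dyadicPt n k) ω|} ≤
          ENNReal.ofReal ((|K| * q ^ n) ^ p * M / (r ^ n) ^ (2 * p)) := by
      intro k hk
      have hk' := Finset.mem_range.1 hk
      rw [← ofReal_measureReal]
      refine ENNReal.ofReal_le_ofReal ((measureReal_abs_gt_le ((hm _).sub (hm _)) (hlaw _ _) p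
        (pow_pos hr n)).trans ?_)
      have hle1 : ∀ j ≤ N * 2 ^ n, dyadicPt n j ≤ N := by
        intro j hj
        rw [dyadicPt, div_le_iff₀ (by positivity)]
        exact_mod_cast hj
      have hV : (V (dyadicPt n k) (dyadicPt n (k + 1)) : ℝ) ≤ |K| * q ^ n := by
        refine (hK _ _ (hle1 k hk'.le) (hle1 (k + 1) hk')).trans ?_
        have e1 : |(dyadicPt n (k + 1) : ℝ) - dyadicPt n k| ^ β = q ^ n := by
          rw [coe_dyadicPt, coe_dyadicPt, ← sub_div, Nat.cast_add_one, add_sub_cancel_left,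
            abs_of_pos (by positivity), ← one_div_pow, ← Real.rpow_natCast, ← Real.rpow_mul
            (by norm_num), hqdef, ← Real.rpow_natCast, ← Real.rpow_mul (by norm_num), mul_comm]
        rw [e1]
        gcongr
        exact le_abs_self K
      gcongr
    refine (measure_biUnion_finset_le _ _).trans ((Finset.sum_le_sum hk).trans (le_of_eq ?_))
    rw [Finset.sum_const, Finset.card_range, nsmul_eq_mul, ← ENNReal.ofReal_natCast,
      ← ENNReal.ofReal_mul (by positivity)]
    congr 1
    rw [hρdef, mul_pow, mul_pow, ← pow_mul, div_pow, ← pow_mul, ← pow_mul, div_pow,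
      ← pow_mul, ← pow_mul, mul_comm p n, mul_comm (2 * p) n]
    push_cast
    ring
  have hsum : ∑' n, P (s n) ≠ ⊤ := by
    refine ne_top_of_le_ne_top ?_ (ENNReal.tsum_le_tsum hle)
    exact ((summable_geometric_of_lt_one hρ0 hρ1).mul_left _).tsum_ofReal_ne_top
  filter_upwards [ae_eventually_notMem hsum] with ω hω
  filter_upwards [hω] with n hn k hk
  by_contra hcon
  exact hn (Set.mem_biUnion (Finset.mem_coe.2 (Finset.mem_range.2 hk)) (not_le.1 hcon))

/-- A centered process with Gaussian increments whose variances are locally bounded by `K |t-s|^β`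
has a version with locally Hölder continuous paths, for all exponents below `β / 2` at once. -/
theorem exists_holder_version (hm : ∀ t, Measurable (ξ t))
    (hlaw : ∀ s t, P.map (fun ω => ξ t ω - ξ s ω) = gaussianReal 0 (V s t)) (hβ : 0 < β)
    (hV : ∀ T : ℝ≥0, 0 < T → ∃ K : ℝ, ∀ s t : ℝ≥0, s ≤ T → t ≤ T →
      (V s t : ℝ) ≤ K * |(t : ℝ) - s| ^ β) :
    ∃ η : ℝ≥0 → Ω → ℝ, (∀ t, Measurable (η t)) ∧ (∀ t, η t =ᵐ[P] ξ t) ∧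
      ∀ ω, Continuous (fun t => η t ω) ∧ ∀ (γ : ℝ≥0) (T : ℝ≥0), 0 < γ → (γ : ℝ) < β / 2 →
        ∃ K : ℝ≥0, HolderOnWith K γ (fun t => η t ω) (Set.Iic T) := by
  -- rational exponents, so that a single null set serves all of them
  have hgood : ∀ᵐ ω ∂P, ∀ (N : ℕ) (γ : ℚ), (γ : ℝ) < β / 2 → ∀ᶠ n in atTop, ∀ k, k < N * 2 ^ n →
      |ξ (dyadicPt n (k + 1)) ω - ξ (dyadicPt n k) ω| ≤ ((1 / 2 : ℝ) ^ (γ : ℝ)) ^ n := by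
    rw [ae_all_iff]
    intro N
    rw [ae_all_iff]
    intro γ
    by_cases hγ : (γ : ℝ) < β / 2
    · rcases Nat.eq_zero_or_pos N with rfl | hN
      · exact ae_of_all _ fun ω _ => Eventually.of_forall fun n k hk => by simp at hk
      obtain ⟨K, hK⟩ := hV N (by exact_mod_cast hN)
      filter_upwards [ae_eventually_dyadic_increments_le hm hlaw hK hγ] with ω hω _ using hω
    · exact ae_of_all _ fun ω h => absurd h hγ
  obtain ⟨G, hGae, hGm, hG⟩ := hgood.exists_measurable_mem
  -- geometric bounds on `G` for all real exponents below `β / 2`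
  have hGC : ∀ ω ∈ G, ∀ (N : ℕ) (γ : ℝ), γ < β / 2 → ∃ C : ℝ, 0 ≤ C ∧ ∀ n k, k < N * 2 ^ n →
      |ξ (dyadicPt n (k + 1)) ω - ξ (dyadicPt n k) ω| ≤ C * ((1 / 2 : ℝ) ^ γ) ^ n := by
    intro ω hω N γ hγ
    obtain ⟨q, hq1, hq2⟩ := exists_rat_btwn hγ
    refine exists_const_of_eventually (x := fun t => ξ t ω) (by positivity) ?_
    filter_upwards [hG ω hω N q hq2] with n hn k hk
    refine (hn k hk).trans ?_
    gcongr ?_ ^ n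
    exact Real.rpow_le_rpow_of_exponent_ge (by norm_num) (by norm_num) hq1.le
  have hlt : ∀ t : ℝ≥0, ∃ N : ℕ, t < N := fun t => exists_nat_gt t
  have hlim : ∀ ω ∈ G, ∀ t, Tendsto (fun n => ξ (dyadicFloor n t) ω) atTop
      (𝓝 (dyadicLim (fun t => ξ t ω) t)) := by
    intro ω hω t
    obtain ⟨N, hN⟩ := hlt t
    obtain ⟨C, hC0, hC⟩ := hGC ω hω N (β / 4) (by linarith)
    exact tendsto_dyadicLim (x := fun t => ξ t ω) hC0 (by positivity)
      (Real.rpow_lt_one (by norm_num) (by norm_num) (by positivity)) hC hN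
  have hhol : ∀ ω ∈ G, ∀ (γ : ℝ≥0) (T : ℝ≥0), 0 < γ → (γ : ℝ) < β / 2 →
      ∃ K : ℝ≥0, HolderOnWith K γ (dyadicLim fun t => ξ t ω) (Set.Iic T) := by
    intro ω hω γ T hγ0 hγ
    obtain ⟨N, hN⟩ := hlt T
    obtain ⟨C, hC0, hC⟩ := hGC ω hω N γ hγ
    obtain ⟨K, hK0, hK⟩ := exists_dyadicLim_holder (x := fun t => ξ t ω)
      (by exact_mod_cast hγ0) hC0 hC
    refine ⟨K.toNNReal, ?_⟩
    have key : ∀ s t : ℝ≥0, s ≤ t → t ≤ T →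
        edist (dyadicLim (fun t => ξ t ω) t) (dyadicLim (fun t => ξ t ω) s) ≤
          K.toNNReal * edist t s ^ (γ : ℝ) := by
      intro s t hst ht
      have h1 := hK s t hst (ht.trans_lt hN)
      have hst' : (s : ℝ) ≤ t := hst
      rw [edist_dist, Real.dist_eq, edist_dist, NNReal.dist_eq, abs_of_nonneg (sub_nonneg.2 hst'),
        ENNReal.ofReal_rpow_of_nonneg (sub_nonneg.2 hst') γ.coe_nonneg]
      change _ ≤ ENNReal.ofReal K * _
      rw [← ENNReal.ofReal_mul hK0]
      exact ENNReal.ofReal_le_ofReal h1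
    intro s hs t ht
    rcases le_total s t with hst | hst
    · rw [edist_comm, edist_comm s]
      exact key s t hst ht
    · exact key t s hst hs
  classical
  -- off `G` the path is set to zero, which makes every path continuous
  let η : ℝ≥0 → Ω → ℝ := fun t => G.indicator fun ω => dyadicLim (fun t => ξ t ω) t
  have hη : ∀ t ω, Tendsto (fun n => G.indicator (fun ω => ξ (dyadicFloor n t) ω) ω) atTop
      (𝓝 (η t ω)) := by
    intro t ω
    by_cases hω : ω ∈ G
    · simpa [η, hω] using hlim ω hω t
    · simp [η, hω]
  have hηm : ∀ t, Measurable (η t) := fun t =>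
    measurable_of_tendsto_metrizable (fun n => (hm (dyadicFloor n t)).indicator hGm)
      (tendsto_pi_nhds.2 (hη t))
  refine ⟨η, hηm, fun t => ?_, fun ω => ?_⟩
  · have h1 : TendstoInMeasure P (fun n => ξ (dyadicFloor n t)) atTop (η t) := by
      refine tendstoInMeasure_of_tendsto_ae (fun n => (hm _).aestronglyMeasurable) ?_
      filter_upwards [hGae] with ω hω
      simpa [η, hω] using hlim ω hω t
    have h2 : TendstoInMeasure P (fun n => ξ (dyadicFloor n t)) atTop (ξ t) := by
      obtain ⟨K, hK⟩ := hV (t + 1) (by positivity)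
      have hV0 : Tendsto (fun n => (V (dyadicFloor n t) t : ℝ)) atTop (𝓝 0) := by
        have hd : Tendsto (fun n => |K| * (((1 / 2 : ℝ) ^ n) ^ β)) atTop (𝓝 0) := by
          have := (tendsto_pow_atTop_nhds_zero_of_lt_one (r := (1 / 2 : ℝ)) (by norm_num)
            (by norm_num)).rpow_const (p := β) (Or.inr hβ.le)
          rw [Real.zero_rpow hβ.ne'] at this
          simpa using this.const_mul |K|
        refine squeeze_zero (fun n => (V _ _).2) (fun n => ?_) hd
        have hle := dyadicFloor_le n t
        refine (hK _ _ (hle.trans le_self_add) le_self_add).trans ?_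
        have hle' : (dyadicFloor n t : ℝ) ≤ t := hle
        rw [abs_of_nonneg (sub_nonneg.2 hle')]
        have := sub_dyadicFloor_le n t
        have h0 := sub_nonneg.2 hle'
        gcongr
        exact le_abs_self K
      intro ε hε
      obtain rfl | hεt := eq_or_ne ε ⊤
      · simp
      set a := ε.toReal / 2
      have ha : 0 < a := half_pos (ENNReal.toReal_pos hε.ne' hεt)
      have hb := fun n => measureReal_abs_gt_le ((hm t).sub (hm (dyadicFloor n t)))
        (hlaw (dyadicFloor n t) t) 1 ha
      have hb0 : Tendsto (fun n => P.real {ω | a < |ξ t ω - ξ (dyadicFloor n t) ω|}) atTop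
          (𝓝 0) := by
        refine squeeze_zero (fun n => measureReal_nonneg) hb ?_
        have := ((hV0.pow 1).mul_const (∫ x, x ^ (2 * 1) ∂(gaussianReal 0 1))).div_const
          (a ^ (2 * 1))
        simpa using this
      have hb1 : Tendsto (fun n => P {ω | a < |ξ t ω - ξ (dyadicFloor n t) ω|}) atTop
          (𝓝 0) := by
        have := (ENNReal.continuous_ofReal.tendsto 0).comp hb0
        simpa [Function.comp_def, ofReal_measureReal] using this
      refine tendsto_of_tendsto_of_tendsto_of_le_of_le tendsto_const_nhds hb1
        (fun n => zero_le) fun n => measure_mono fun ω hω => ?_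
      simp only [Set.mem_ofPred_eq] at hω ⊢
      rw [edist_dist, Real.dist_eq, abs_sub_comm, ENNReal.le_ofReal_iff_toReal_le hεt
        (abs_nonneg _)] at hω
      exact (half_lt_self (ENNReal.toReal_pos hε.ne' hεt)).trans_le hω
    exact tendstoInMeasure_ae_unique h1 h2
  · by_cases hω : ω ∈ G
    · have heq : (fun t => η t ω) = dyadicLim fun t => ξ t ω := by
        ext t
        simp [η, hω]
      rw [heq]
      refine ⟨?_, hhol ω hω⟩
      rw [continuous_iff_continuousAt]
      intro t
      have hγ : ((β / 4).toNNReal : ℝ) = β / 4 := Real.coe_toNNReal _ (by positivity)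
      have hγ0 : 0 < (β / 4).toNNReal := by
        rw [← NNReal.coe_pos, hγ]
        positivity
      obtain ⟨K, hK⟩ := hhol ω hω (β / 4).toNNReal (t + 1) hγ0 (by rw [hγ]; linarith)
      exact (hK.continuousOn hγ0).continuousAt (Iic_mem_nhds (lt_add_one t))
    · have heq : (fun t => η t ω) = fun _ => 0 := by
        ext t
        simp [η, hω]
      rw [heq]
      refine ⟨continuous_const, fun γ T hγ0 _ => ⟨0, fun s _ t _ => by simp⟩⟩

end Version

/-! ### Test functions -/

namespace IsTestClass

variable {f g : ℝ → ℝ}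

lemma aestronglyMeasurable (hf : IsTestClass f) : AEStronglyMeasurable f := by
  have hD := hf.finite_discontinuities
  have hc : ContinuousOn f {x | ¬ ContinuousAt f x}ᶜ := fun x hx =>
    (not_not.1 hx : ContinuousAt f x).continuousWithinAt
  have := hc.aestronglyMeasurable (μ := volume) hD.measurableSet.compl
  have hae : ∀ᵐ x : ℝ, x ∈ {x | ¬ ContinuousAt f x}ᶜ := compl_mem_ae_iff.2 (hD.measure_zero _)
  rwa [Measure.restrict_eq_self_of_ae_mem hae] at this

lemma memLp (hf : IsTestClass f) (p : ENNReal) : MemLp f p := by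
  obtain ⟨M, hM⟩ := hf.bounded
  exact hf.hasCompactSupport.memLp_of_bound hf.aestronglyMeasurable M (ae_of_all _ hM)

lemma integrable (hf : IsTestClass f) : Integrable f :=
  memLp_one_iff_integrable.1 (hf.memLp 1)

end IsTestClass

lemma memLp_unitFamily (t : ℝ≥0) (p : ENNReal) : MemLp (unitFamily t) p :=
  memLp_indicator_const p measurableSet_Icc 1 (Or.inr (by simp))

lemma hasCompactSupport_unitFamily (t : ℝ≥0) : HasCompactSupport (unitFamily t) :=
  HasCompactSupport.intro isCompact_Icc fun _ hx => Set.indicator_of_notMem hx _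

lemma integral_unitFamily (t : ℝ≥0) : ∫ x, unitFamily t x = t := by
  rw [unitFamily, integral_indicator measurableSet_Icc]
  simp

/-- Increments of `t ↦ 1_{[0,t]}` are translates of each other. -/
lemma unitFamily_add_sub (s t h : ℝ≥0) (x : ℝ) :
    unitFamily (t + h) x - unitFamily (s + h) x =
      unitFamily t (x - h) - unitFamily s (x - h) := by
  have := t.2; have := s.2; have := h.2
  simp only [unitFamily, Set.indicator_apply, Set.mem_Icc, NNReal.coe_add]
  simp only [NNReal.val_eq_coe] at *
  split_ifs <;> grind

/-! ### The sign of the correlations -/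

section Sign

variable {α m v : ℝ} {f g : ℝ → ℝ}

lemma integrable_stableDensity_mul_prod (hα : 0 < α) (hα2 : α ≤ 2) (hf : Integrable f)
    (hg : Integrable g) :
    Integrable fun z : ℝ × ℝ => stableDensity α 2 (z.1 - z.2) * (f z.1 * g z.2) := by
  have hpc := continuous_stableDensity hα two_pos
  refine (hf.mul_prod hg).bdd_mul (c := stableDensity α 2 0)
    (Continuous.aestronglyMeasurable (by fun_prop)) (ae_of_all _ fun z => ?_)
  rw [Real.norm_eq_abs, abs_of_nonneg (stableDensity_nonneg hα hα2 two_pos _)]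
  exact stableDensity_le hα hα2 two_pos _

lemma integral_stableDensity_mul_nonneg (hα : 0 < α) (hα2 : α ≤ 2) (hf : ∀ x, 0 ≤ f x)
    (hg : ∀ x, 0 ≤ g x) :
    0 ≤ ∫ z : ℝ × ℝ, stableDensity α 2 (z.1 - z.2) * (f z.1 * g z.2) :=
  integral_nonneg fun _ => mul_nonneg (stableDensity_nonneg hα hα2 two_pos _)
    (mul_nonneg (hf _) (hg _))

/-- For odd functions that are non-negative on the half-line, the reflection `x ↦ -x` turns the
double integral into half the integral of `(p (x - y) - p (x + y)) f(x) g(y)`, whose integrand is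
non-negative because `p` decreases in `|x|`. -/
lemma integral_stableDensity_mul_nonneg_of_odd (hα : 0 < α) (hα2 : α ≤ 2) (hfi : Integrable f)
    (hgi : Integrable g) (hf : ∀ x, 0 ≤ x → 0 ≤ f x) (hg : ∀ x, 0 ≤ x → 0 ≤ g x)
    (hfo : ∀ x, f (-x) = -f x) (hgo : ∀ x, g (-x) = -g x) :
    0 ≤ ∫ z : ℝ × ℝ, stableDensity α 2 (z.1 - z.2) * (f z.1 * g z.2) := by
  set F : ℝ × ℝ → ℝ := fun z => stableDensity α 2 (z.1 - z.2) * (f z.1 * g z.2) with hF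
  have hFi : Integrable F := integrable_stableDensity_mul_prod hα hα2 hfi hgi
  have hmp : MeasurePreserving (fun z : ℝ × ℝ => (-z.1, z.2)) volume volume :=
    (Measure.measurePreserving_neg (volume : Measure ℝ)).prod (MeasurePreserving.id volume)
  have hemb : MeasurableEmbedding (fun z : ℝ × ℝ => (-z.1, z.2)) :=
    ((MeasurableEquiv.neg ℝ).prodCongr (MeasurableEquiv.refl ℝ)).measurableEmbedding
  have hrefl : ∫ z : ℝ × ℝ, F (-z.1, z.2) = ∫ z, F z := hmp.integral_comp hemb F
  have hrefli : Integrable fun z : ℝ × ℝ => F (-z.1, z.2) :=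
    (hmp.integrable_comp_emb hemb).2 hFi
  have hsum : 0 ≤ ∫ z : ℝ × ℝ, (F z + F (-z.1, z.2)) := by
    refine integral_nonneg fun z => ?_
    obtain ⟨x, y⟩ := z
    have hfs : ∀ x, x ≤ 0 → f x ≤ 0 := fun x hx => by
      have := hf (-x) (by linarith); rw [hfo] at this; linarith
    have hgs : ∀ x, x ≤ 0 → g x ≤ 0 := fun x hx => by
      have := hg (-x) (by linarith); rw [hgo] at this; linarith
    have hq : stableDensity α 2 (-x - y) = stableDensity α 2 (x + y) := by
      rw [← stableDensity_neg]; congr 1; ring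
    simp only [Pi.zero_apply, hF, hfo, hq]
    have key : 0 ≤ (stableDensity α 2 (x - y) - stableDensity α 2 (x + y)) * (f x * g y) := by
      rcases le_total 0 x with hx | hx <;> rcases le_total 0 y with hy | hy
      · refine mul_nonneg (sub_nonneg.2 (stableDensity_anti hα hα2 two_pos ?_))
          (mul_nonneg (hf x hx) (hg y hy))
        rw [← sq_le_sq]; nlinarith
      · refine mul_nonneg_of_nonpos_of_nonpos
          (sub_nonpos.2 (stableDensity_anti hα hα2 two_pos ?_))
          (mul_nonpos_of_nonneg_of_nonpos (hf x hx) (hgs y hy))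
        rw [← sq_le_sq]; nlinarith
      · refine mul_nonneg_of_nonpos_of_nonpos
          (sub_nonpos.2 (stableDensity_anti hα hα2 two_pos ?_))
          (mul_nonpos_of_nonpos_of_nonneg (hfs x hx) (hg y hy))
        rw [← sq_le_sq]; nlinarith
      · refine mul_nonneg (sub_nonneg.2 (stableDensity_anti hα hα2 two_pos ?_))
          (mul_nonneg_of_nonpos_of_nonpos (hfs x hx) (hgs y hy))
        rw [← sq_le_sq]; nlinarith
    linarith
  rw [integral_add hFi hrefli, hrefl] at hsum
  linarith

/-- The covariance of disjointly supported increments: the diagonal term vanishes, and the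
smoothing term is non-negative. -/
lemma exists_covForm_increments (hα : 0 < α) (hα2 : α ≤ 2) {ψ : ℝ≥0 → ℝ → ℝ}
    (hψ : ∀ t, IsTestClass (ψ t)) (hd : DisjointIncrements ψ) (hmo : MonotoneOrOdd ψ) (m v : ℝ)
    {s t u w : ℝ≥0} (hst : s < t) (htu : t ≤ u) (huw : u < w) :
    ∃ B : ℝ, 0 ≤ B ∧
      covForm α m v (fun x => ψ t x - ψ s x) (fun x => ψ w x - ψ u x) = (v - m) * B := by
  refine ⟨∫ z : ℝ × ℝ, stableDensity α 2 (z.1 - z.2) *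
    ((ψ t z.1 - ψ s z.1) * (ψ w z.2 - ψ u z.2)), ?_, ?_⟩
  · rcases hmo with hmono | ⟨hmono, hodd⟩
    · exact integral_stableDensity_mul_nonneg hα hα2 (f := fun x => ψ t x - ψ s x)
        (g := fun x => ψ w x - ψ u x) (fun x => sub_nonneg.2 (hmono x hst.le))
        (fun x => sub_nonneg.2 (hmono x huw.le))
    · refine integral_stableDensity_mul_nonneg_of_odd hα hα2 (f := fun x => ψ t x - ψ s x)
        (g := fun x => ψ w x - ψ u x) ((hψ t).integrable.sub (hψ s).integrable)
        ((hψ w).integrable.sub (hψ u).integrable)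
        (fun x hx => sub_nonneg.2 (hmono x hx hst.le))
        (fun x hx => sub_nonneg.2 (hmono x hx huw.le)) (fun x => ?_) (fun x => ?_)
      · rw [hodd, hodd]; ring
      · rw [hodd, hodd]; ring
  · have h0 : ∀ x, (ψ t x - ψ s x) * (ψ w x - ψ u x) = 0 := fun x => by
      by_contra hx
      obtain ⟨h1, h2⟩ := mul_ne_zero_iff.1 hx
      exact Set.disjoint_left.1 (hd s t u w hst htu huw)
        (show x ∈ Function.support (ψ t - ψ s) from h1) h2
    rw [covForm_eq hα hα2]
    simp [h0]

end Sign

/-! ### Long range dependence -/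

section LongRange

variable {α m v : ℝ} {f g : ℝ → ℝ}

lemma tendsto_rpow_mul_stableDensity_sub (hα : 0 < α) (hα2 : α ≤ 2) (d : ℝ) :
    Tendsto (fun τ : ℝ => τ ^ (1 + α) * stableDensity α 2 (τ - d)) atTop
      (𝓝 (tailConst α 2)) := by
  have h1 : Tendsto (fun τ : ℝ => τ - d) atTop atTop := tendsto_atTop_add_const_right _ _ tendsto_id
  have h2 := (tendsto_stableDensity hα hα2 two_pos).comp h1
  have h3 : Tendsto (fun τ : ℝ => (1 + d / (τ - d)) ^ (1 + α)) atTop (𝓝 1) := by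
    have h4 : Tendsto (fun τ : ℝ => 1 + d / (τ - d)) atTop (𝓝 1) := by
      simpa using (h1.const_div_atTop d).const_add 1
    simpa using h4.rpow_const (p := 1 + α) (Or.inl one_ne_zero)
  have h5 := h3.mul h2
  rw [one_mul] at h5
  refine h5.congr' ?_
  filter_upwards [eventually_gt_atTop 0, eventually_gt_atTop d] with τ h0 hd
  have hpos : 0 < τ - d := by linarith
  simp only [Function.comp_apply]
  rw [← mul_assoc, ← Real.mul_rpow _ hpos.le]
  · congr 2
    field_simp
    ring
  · rw [show 1 + d / (τ - d) = τ / (τ - d) by field_simp; ring]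
    positivity

/-- Domination on bounded sets: by unimodality the largest value is the one at `d = R`. -/
lemma exists_rpow_mul_stableDensity_le (hα : 0 < α) (hα2 : α ≤ 2) (R : ℝ) :
    ∃ M : ℝ, 0 ≤ M ∧ ∀ᶠ τ : ℝ in atTop, ∀ d, |d| ≤ R →
      τ ^ (1 + α) * stableDensity α 2 (τ - d) ≤ M := by
  have h := (tendsto_rpow_mul_stableDensity_sub hα hα2 R).eventually_le_const
    (lt_add_one (tailConst α 2))
  refine ⟨max (tailConst α 2 + 1) 0, le_max_right _ _, ?_⟩
  filter_upwards [h, eventually_ge_atTop 0, eventually_ge_atTop R] with τ h1 h0 hR d hd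
  refine le_trans ?_ (h1.trans (le_max_left _ _))
  have := abs_le.1 hd
  gcongr
  refine stableDensity_anti hα hα2 two_pos ?_
  rw [abs_of_nonneg (by linarith), abs_of_nonneg (by linarith)]
  linarith

/-- Decay of the covariance under a large shift of the second argument. -/
lemma tendsto_covForm_shift (hα : 0 < α) (hα2 : α ≤ 2) (m v : ℝ) (hf : Integrable f)
    (hg : Integrable g) (hfc : HasCompactSupport f) (hgc : HasCompactSupport g) :
    Tendsto (fun τ : ℝ => τ ^ (1 + α) * covForm α m v f (fun x => g (x - τ))) atTop
      (𝓝 (tailConst α 2 * (v - m) * (∫ x, f x) * ∫ x, g x)) := by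
  obtain ⟨R₁, hR₁⟩ := hfc.isCompact.isBounded.exists_norm_le
  obtain ⟨R₂, hR₂⟩ := hgc.isCompact.isBounded.exists_norm_le
  have hf0 : ∀ x, f x ≠ 0 → |x| ≤ R₁ := fun x hx => hR₁ x (subset_tsupport f hx)
  have hg0 : ∀ x, g x ≠ 0 → |x| ≤ R₂ := fun x hx => hR₂ x (subset_tsupport g hx)
  have hpc := continuous_stableDensity hα two_pos
  obtain ⟨M, hM0, hM⟩ := exists_rpow_mul_stableDensity_le hα hα2 (R₁ + R₂)
  have hlim : Tendsto (fun τ : ℝ => ∫ z : ℝ × ℝ,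
      (τ ^ (1 + α) * stableDensity α 2 (τ - (z.1 - z.2))) * (f z.1 * g z.2)) atTop
      (𝓝 (∫ z : ℝ × ℝ, tailConst α 2 * (f z.1 * g z.2))) := by
    refine tendsto_integral_filter_of_dominated_convergence
      (fun z => M * ‖f z.1 * g z.2‖) ?_ ?_ ((hf.mul_prod hg).norm.const_mul M) ?_
    · refine Eventually.of_forall fun τ => ?_
      exact (Continuous.aestronglyMeasurable (by fun_prop)).mul (hf.mul_prod hg).aestronglyMeasurable
    · filter_upwards [hM, eventually_ge_atTop 0] with τ hτ h0
      refine ae_of_all _ fun z => ?_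
      rw [norm_mul]
      by_cases hz : f z.1 * g z.2 = 0
      · simp [hz]
      · obtain ⟨h1, h2⟩ := mul_ne_zero_iff.1 hz
        gcongr
        rw [Real.norm_of_nonneg (mul_nonneg (by positivity)
          (stableDensity_nonneg hα hα2 two_pos _))]
        exact hτ _ ((abs_sub _ _).trans (add_le_add (hf0 _ h1) (hg0 _ h2)))
    · exact ae_of_all _ fun z =>
        (tendsto_rpow_mul_stableDensity_sub hα hα2 (z.1 - z.2)).mul_const _
  have hval : ∫ z : ℝ × ℝ, tailConst α 2 * (f z.1 * g z.2) =
      tailConst α 2 * ((∫ x, f x) * ∫ x, g x) := by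
    rw [integral_const_mul, Measure.volume_eq_prod, integral_prod_mul]
  rw [hval] at hlim
  have h2 := hlim.const_mul (v - m)
  rw [show (v - m) * (tailConst α 2 * ((∫ x, f x) * ∫ x, g x)) =
    tailConst α 2 * (v - m) * (∫ x, f x) * ∫ x, g x by ring] at h2
  refine h2.congr' ?_
  filter_upwards [eventually_gt_atTop (R₁ + R₂)] with τ hτ
  -- for a large shift the supports are disjoint, so only the smoothing term is left
  have hdiag : ∀ x, f x * g (x - τ) = 0 := fun x => by
    by_contra hx
    obtain ⟨h1, h2⟩ := mul_ne_zero_iff.1 hx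
    have h3 := abs_le.1 (hf0 _ h1)
    have h4 := abs_le.1 (hg0 _ h2)
    linarith
  have hshift := integral_sub_right_eq_self (μ := (volume : Measure (ℝ × ℝ)))
    (fun z : ℝ × ℝ => stableDensity α 2 (τ - (z.1 - z.2)) * (f z.1 * g z.2)) (0, τ)
  rw [covForm_eq hα hα2]
  simp only [hdiag, integral_zero, mul_zero, zero_add, mul_assoc]
  rw [integral_const_mul, ← hshift]
  simp only [Prod.fst_sub, Prod.snd_sub, sub_zero]
  rw [mul_left_comm]
  congr 3
  ext z
  rw [← stableDensity_neg]
  congr 2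
  ring

end LongRange

/-! ### Increments of the process `ϱ` -/

section Rho

variable {Ω : Type*} [MeasurableSpace Ω] {P : Measure Ω} {α m v : ℝ}
  {X : ℝ≥0 → Ω → (𝓢(ℝ, ℝ) →L[ℝ] ℝ)} {ψ : ℝ≥0 → ℝ → ℝ}

lemma isL2Extension_rho_sub (hX : IsDensityProcess P α m v X) (hα : 0 < α) (hα2 : α ≤ 2)
    (hψ : ∀ t, MemLp (ψ t) 2) (s t : ℝ≥0) :
    IsL2Extension P (X 1) (fun x => ψ t x - ψ s x) fun ω => rho P X ψ t ω - rho P X ψ s ω :=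
  (isL2Extension_extPairing hX hα hα2 (hψ t)).sub hX (hψ t) (hψ s)
    (isL2Extension_extPairing hX hα hα2 (hψ s))

lemma covariance_rho_sub (hX : IsDensityProcess P α m v X) (hα : 0 < α) (hα2 : α ≤ 2)
    (hψ : ∀ t, MemLp (ψ t) 2) (s t u w : ℝ≥0) :
    covariance (fun ω => rho P X ψ t ω - rho P X ψ s ω)
      (fun ω => rho P X ψ w ω - rho P X ψ u ω) P =
      covForm α m v (fun x => ψ t x - ψ s x) (fun x => ψ w x - ψ u x) :=
  (isL2Extension_rho_sub hX hα hα2 hψ s t).covariance_eq hX hα hα2 ((hψ t).sub (hψ s))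
    ((hψ w).sub (hψ u)) (isL2Extension_rho_sub hX hα hα2 hψ u w)

lemma identDistrib_shift (hX : IsDensityProcess P α m v X) (hα : 0 < α) (hα2 : α ≤ 2)
    (φ : 𝓢(ℝ, ℝ)) (a : ℝ) :
    IdentDistrib (fun ω => X 1 ω φ) (fun ω => X 1 ω (φ.compSubConstCLM ℝ a)) P P where
  aemeasurable_fst := (hX.measurable 1 _).aemeasurable
  aemeasurable_snd := (hX.measurable 1 _).aemeasurable
  map_eq := by
    rw [hX.map_eq hα hα2, hX.map_eq hα hα2, ← covForm_shift hα hα2 m v φ φ a]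
    rfl

lemma hasStationaryIncrements_rho_unitFamily (hX : IsDensityProcess P α m v X) (hα : 0 < α)
    (hα2 : α ≤ 2) : HasStationaryIncrements (rho P X unitFamily) P := by
  intro h n s t
  have hu := fun t => memLp_unitFamily t 2
  have h1 := fun i => isL2Extension_rho_sub hX hα hα2 hu (s i + h) (t i + h)
  have h2 := fun i => isL2Extension_rho_sub hX hα hα2 hu (s i) (t i)
  refine ⟨(measurable_pi_lambda _ fun i => (h1 i).1).aemeasurable,
    (measurable_pi_lambda _ fun i => (h2 i).1).aemeasurable, ?_⟩
  refine map_pi_eq hX hα hα2 (fun i => (hu _).sub (hu _)) (fun i => (hu _).sub (hu _)) h1 h2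
    fun c => ?_
  simp only [Pi.sub_apply, unitFamily_add_sub]
  exact covForm_shift hα hα2 m v (fun x => ∑ i, c i * (unitFamily (t i) x - unitFamily (s i) x))
    (fun x => ∑ i, c i * (unitFamily (t i) x - unitFamily (s i) x)) (h : ℝ)

/-- For `v = m` the increments are jointly Gaussian and uncorrelated. -/
lemma hasIndepIncrements_rho (hX : IsDensityProcess P α m v X) (hα : 0 < α) (hα2 : α ≤ 2)
    (hψ : ∀ t, IsTestClass (ψ t)) (hd : DisjointIncrements ψ) (hmo : MonotoneOrOdd ψ)
    (hvm : v = m) : HasIndepIncrements (rho P X ψ) P := by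
  intro n t ht
  have hψ2 := fun t => (hψ t).memLp 2
  refine (hasGaussianLaw_pi hX hα hα2 (fun i : Fin n => (hψ2 (t i.succ)).sub (hψ2 (t i.castSucc)))
    fun i => isL2Extension_rho_sub hX hα hα2 hψ2 _ _).iIndepFun_of_covariance_eq_zero
    fun i j hij => ?_
  wlog h : i < j generalizing i j
  · rw [covariance_comm]
    exact this j i hij.symm (lt_of_le_of_ne (not_lt.1 h) hij.symm)
  rw [covariance_rho_sub hX hα hα2 hψ2]
  have h1 : t i.castSucc ≤ t i.succ := ht i.castSucc_lt_succ.le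
  have h2 : t i.succ ≤ t j.castSucc := ht (Fin.succ_le_castSucc_iff.2 h)
  have h3 : t j.castSucc ≤ t j.succ := ht j.castSucc_lt_succ.le
  -- an increment over an empty interval vanishes
  rcases h1.eq_or_lt with h1 | h1
  · rw [h1]
    simp [covForm]
  rcases h3.eq_or_lt with h3 | h3
  · rw [h3]
    simp [covForm]
  obtain ⟨B, -, hB⟩ := exists_covForm_increments hα hα2 hψ hd hmo m v h1 h2 h3
  rw [hB, hvm, sub_self, zero_mul]

end Rho

end DensityProcess

end

theorem proposition2p7 (α : ℝ) (hα0 : 0 < α) (hα2 : α ≤ 2) :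
    -- the constant of part (c) depends on `α` only
    ∃ C : ℝ, (α < 2 → 0 < C) ∧ (α = 2 → C = 0) ∧
    ∀ (Ω₀ : Type*) [MeasurableSpace Ω₀] (P₀ : Measure Ω₀) [IsProbabilityMeasure P₀]
      (θ : Ω₀ → ℕ) (_hθ : Measurable θ) (_hθ3 : Integrable (fun ω => (θ ω : ℝ) ^ 3) P₀)
      (m v : ℝ) (_hm : m = ∫ ω, (θ ω : ℝ) ∂P₀)
      (_hv : v = variance (fun ω => (θ ω : ℝ)) P₀)
      (Ω : Type*) [MeasurableSpace Ω] (P : Measure Ω) [IsProbabilityMeasure P]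
      (X : ℝ≥0 → Ω → (𝓢(ℝ, ℝ) →L[ℝ] ℝ)) (_hX : DensityProcess.IsDensityProcess P α m v X),
    -- (a) homogeneity
    ((∀ (φ : 𝓢(ℝ, ℝ)) (a : ℝ),
        IdentDistrib (fun ω => X 1 ω φ) (fun ω => X 1 ω (φ.compSubConstCLM ℝ a)) P P) ∧
      DensityProcess.HasStationaryIncrements
        (DensityProcess.rho P X DensityProcess.unitFamily) P) ∧
    -- (b) correlation of increments
    (∀ ψ : ℝ≥0 → ℝ → ℝ, (∀ t, DensityProcess.IsTestClass (ψ t)) →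
      DensityProcess.DisjointIncrements ψ → DensityProcess.MonotoneOrOdd ψ →
      (v < m → DensityProcess.HasNegCorrIncrements (DensityProcess.rho P X ψ) P) ∧
      (v = m → HasIndepIncrements (DensityProcess.rho P X ψ) P) ∧
      (m < v → DensityProcess.HasPosCorrIncrements (DensityProcess.rho P X ψ) P)) ∧
    -- (c) long range dependence
    ((∀ φ₁ φ₂ : 𝓢(ℝ, ℝ), HasCompactSupport φ₁ → HasCompactSupport φ₂ →
        Tendsto (fun τ : ℝ => τ ^ (1 + α) *
            ∫ ω, X 1 ω φ₁ * X 1 ω (φ₂.compSubConstCLM ℝ τ) ∂P) atTop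
          (𝓝 (C * (v - m) * (∫ x, φ₁ x) * ∫ x, φ₂ x))) ∧
      (∀ φ₁ φ₂ : ℝ → ℝ, DensityProcess.IsTestClass φ₁ → DensityProcess.IsTestClass φ₂ →
        Tendsto (fun τ : ℝ => τ ^ (1 + α) *
            ∫ ω, DensityProcess.extPairing P (X 1) φ₁ ω *
              DensityProcess.extPairing P (X 1) (fun x => φ₂ (x - τ)) ω ∂P) atTop
          (𝓝 (C * (v - m) * (∫ x, φ₁ x) * ∫ x, φ₂ x))) ∧
      (∀ s t u w : ℝ≥0, s ≤ t → u ≤ w →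
        Tendsto (fun τ : ℝ≥0 => (τ : ℝ) ^ (1 + α) *
            ∫ ω, (DensityProcess.rho P X DensityProcess.unitFamily t ω -
                DensityProcess.rho P X DensityProcess.unitFamily s ω) *
              (DensityProcess.rho P X DensityProcess.unitFamily (w + τ) ω -
                DensityProcess.rho P X DensityProcess.unitFamily (u + τ) ω) ∂P) atTop
          (𝓝 (C * (v - m) * ((t : ℝ) - s) * ((w : ℝ) - u))))) ∧
    -- (d) path continuity: a single version, Hölder on every `[0,T]` with every exponent `< β/2`
    (∀ ψ : ℝ≥0 → ℝ → ℝ, (∀ t, DensityProcess.IsTestClass (ψ t)) →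
      ∀ β : ℝ, 0 < β → β < 2 →
      (∀ T : ℝ≥0, 0 < T → ∃ K : ℝ, ∀ t₁ t₂ : ℝ≥0, t₁ ≤ T → t₂ ≤ T →
        ∫ x, (ψ t₁ x - ψ t₂ x) ^ 2 ≤ K * |(t₁ : ℝ) - t₂| ^ β) →
      ∃ ϱ' : ℝ≥0 → Ω → ℝ, (∀ t, Measurable (ϱ' t)) ∧
        (∀ t, ϱ' t =ᵐ[P] DensityProcess.rho P X ψ t) ∧
        ∀ ω, Continuous (fun t => ϱ' t ω) ∧
          ∀ (γ : ℝ≥0) (T : ℝ≥0), 0 < γ → (γ : ℝ) < β / 2 →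
            ∃ K : ℝ≥0, HolderOnWith K γ (fun t => ϱ' t ω) (Set.Iic T)) := by
  refine ⟨DensityProcess.tailConst α 2, fun h => DensityProcess.tailConst_pos hα0 h two_pos,
    fun h => by simp [DensityProcess.tailConst, h], ?_⟩
  intro Ω₀ _ P₀ _ θ _ _ m v _ _ Ω _ P _ X hX
  refine ⟨⟨fun φ a => DensityProcess.identDistrib_shift hX hα0 hα2 φ a,
    DensityProcess.hasStationaryIncrements_rho_unitFamily hX hα0 hα2⟩, fun ψ hψ hd hmo => ?_,
    ⟨fun φ₁ φ₂ h₁ h₂ => ?_, fun φ₁ φ₂ h₁ h₂ => ?_, fun s t u w _ _ => ?_⟩,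
    fun ψ hψ β hβ _ hK => ?_⟩
  · have hψ2 := fun t => (hψ t).memLp 2
    refine ⟨fun hvm s t u w hst htu huw => ?_,
      DensityProcess.hasIndepIncrements_rho hX hα0 hα2 hψ hd hmo,
      fun hvm s t u w hst htu huw => ?_⟩ <;>
    obtain ⟨B, hB0, hB⟩ :=
      DensityProcess.exists_covForm_increments hα0 hα2 hψ hd hmo m v hst htu huw <;>
    rw [DensityProcess.covariance_rho_sub hX hα0 hα2 hψ2, hB]
    · exact mul_nonpos_of_nonpos_of_nonneg (by linarith) hB0
    · exact mul_nonneg (by linarith) hB0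
  · simp only [hX.integral_mul hα0 hα2]
    exact DensityProcess.tendsto_covForm_shift hα0 hα2 m v φ₁.integrable φ₂.integrable h₁ h₂
  · have hs : ∀ τ : ℝ, MemLp (fun x => φ₂ (x - τ)) 2 := fun τ =>
      (h₂.memLp 2).comp_measurePreserving (measurePreserving_sub_right volume τ)
    simp only [(DensityProcess.isL2Extension_extPairing hX hα0 hα2 (h₁.memLp 2)).integral_mul
      hX hα0 hα2 (h₁.memLp 2) (hs _)
      (DensityProcess.isL2Extension_extPairing hX hα0 hα2 (hs _))]
    exact DensityProcess.tendsto_covForm_shift hα0 hα2 m v h₁.integrable h₂.integrable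
      h₁.hasCompactSupport h₂.hasCompactSupport
  · have hu := fun t => DensityProcess.memLp_unitFamily t 2
    have hui := fun t => memLp_one_iff_integrable.1 (DensityProcess.memLp_unitFamily t 1)
    have huc := DensityProcess.hasCompactSupport_unitFamily
    have h := (DensityProcess.tendsto_covForm_shift hα0 hα2 m v ((hui t).sub (hui s))
      ((hui w).sub (hui u)) ((huc t).sub (huc s)) ((huc w).sub (huc u))).comp
      (NNReal.tendsto_coe_atTop.2 tendsto_id)
    simp only [Pi.sub_apply] at h
    rw [integral_sub (hui t) (hui s), integral_sub (hui w) (hui u)] at h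
    simp only [DensityProcess.integral_unitFamily] at h
    refine h.congr fun τ => ?_
    rw [(DensityProcess.isL2Extension_rho_sub hX hα0 hα2 hu s t).integral_mul hX hα0 hα2
      ((hu _).sub (hu _)) ((hu _).sub (hu _))
      (DensityProcess.isL2Extension_rho_sub hX hα0 hα2 hu (u + τ) (w + τ))]
    have e : (DensityProcess.unitFamily (w + τ) - DensityProcess.unitFamily (u + τ)) = fun x =>
        DensityProcess.unitFamily w (x - τ) - DensityProcess.unitFamily u (x - τ) :=
      funext (DensityProcess.unitFamily_add_sub u w τ)
    rw [e]
    rfl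
  · have hψ2 := fun t => (hψ t).memLp 2
    have hext := DensityProcess.isL2Extension_rho_sub hX hα0 hα2 hψ2
    have hsub := fun s t => (hψ2 t).sub (hψ2 s)
    refine DensityProcess.exists_holder_version
      (fun t => (DensityProcess.isL2Extension_extPairing hX hα0 hα2 (hψ2 t)).1)
      (fun s t => (hext s t).map_eq hX hα0 hα2 (hsub s t)) hβ fun T hT => ?_
    obtain ⟨K, hK⟩ := hK T hT
    refine ⟨(|m| + |v - m|) * K, fun s t hs ht => ?_⟩
    rw [Real.coe_toNNReal _ ((hext s t).covForm_nonneg hX hα0 hα2 (hsub s t)), mul_assoc]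
    exact (DensityProcess.covForm_self_le hα0 hα2 m v (hsub s t)).trans
      (mul_le_mul_of_nonneg_left (hK t s ht hs) (by positivity))
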